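/- Let $k$ be a non-archimedean local field with ring of integers $A$, let $\pi$ denote a uniformizer of $A$, let $K$ be the unramified quadratic extension of $k$ with ring of integers $A_K$, and let $\tau$ be the non-trivial automorphism of $K$ over $k$. (No assumption is made on the residue characteristic.) The quotient $A_K/\pi A_K$ is the quadratic extension of the residue field $A/\pi A$. Let $V$ be a vector space of finite dimension $n \ge 1$ over $K$ with a non-degenerate Hermitian form $\phi : V \times V \to K$, that is, $\phi$ is $K$-linear in the first variable and $\phi(w,v) = \phi(v,w)^{\tau}$. Let $d = \det(\phi(e_i,e_j)) \in k^{*}$ for a basis $(e_i)$ of $V$; its class in $k^{*}/N(K^{*})$, where $N$ is the norm from $K$ to $k$, does not depend on the basis. Let $U(V)$ be the group of $K$-linear automorphisms of $V$ that preserve $\phi$. A lattice in $V$ is a free $A_K$-submodule $L$ of rank $n$ which spans $V$ over $K$ and on which $\phi$ takes values in $A_K$. Its dual is $L^\vee = \{v \in V : \phi(v,w) \in A_K \text{ for all } w \in L\} \supseteq L$, and $L$ is non-degenerate (self-dual) if $L^\vee = L$. **Theorem 7.1.** (1) If $d \in N(K^{*})$, then $V$ contains a non-degenerate lattice, and any two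 non-degenerate lattices in $V$ are conjugate under $U(V)$. (2) If $d \notin N(K^{*})$, then $V$ contains no non-degenerate lattice. However, $V$ contains lattices $L$ such that $L^\vee/L$ is a one-dimensional vector space over $A_K/\pi A_K$, i.e. $L^\vee/L \cong A_K/\pi A_K$ as $A_K$-modules. For every such $L$ and every uniformizer $\pi$ of $A$, the form $\pi\phi$ takes values in $A_K$ on $L^\vee$ and induces on $L^\vee/L$ a non-degenerate Hermitian form with values in $A_K/\pi A_K$ (with respect to the involution induced by $\tau$), so that $L^\vee/L$ is a one-dimensional Hermitian space over $A_K/\pi A_K$. Any two such lattices are conjugate under $U(V)$. -/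

import Mathlib

open scoped ValuativeRel

namespace HermitianLattices

noncomputable section

/-- `K` is an unramified quadratic extension of the local field `k`: it has degree two, and its ring
of integers (the integral closure of `𝒪[k]` in `K`) is unramified over `𝒪[k]`. -/
structure IsUnramifiedQuadratic (k K : Type*) [Field k] [ValuativeRel k] [Field K] [Algebra k K] :
    Prop where
  finrank_eq_two : Module.finrank k K = 2
  unramified : Algebra.Unramified 𝒪[k] (integralClosure 𝒪[k] K)

/-- The ring `A_K / π A_K`, where `A` is a local ring with maximal ideal `π A`, and `A_K` is its
integral closure in `K`. When `A` is the ring of integers of a local field `k` and `K` is an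
unramified quadratic extension of `k`, this is the residue field of `A_K`, which is the quadratic
extension of the residue field `A / π A`. -/
abbrev QuadResidue (A K : Type*) [CommRing A] [IsLocalRing A] [Field K] [Algebra A K] : Type _ :=
  integralClosure A K ⧸
    (IsLocalRing.maximalIdeal A).map (algebraMap A (integralClosure A K))

section Conjugation

variable (A : Type*) {k K : Type*} [CommRing A] [Field k] [Field K] [Algebra A k] [Algebra A K]
  [Algebra k K] [IsScalarTower A k K]

/-- The restriction to `A_K` of an automorphism `τ` of `K` over `k`. -/
def intConj (τ : K ≃ₐ[k] K) : integralClosure A K →ₐ[A] integralClosure A K :=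
  ((τ : K →ₐ[k] K).restrictScalars A).mapIntegralClosure

/-- The endomorphism of `A_K / π A_K` that `τ` induces. -/
def residueConj [IsLocalRing A] (τ : K ≃ₐ[k] K) : QuadResidue A K →+* QuadResidue A K :=
  Ideal.quotientMap _ (intConj A τ : integralClosure A K →+* integralClosure A K) (by
    rw [Ideal.map_le_iff_le_comap]
    intro x hx
    rw [Ideal.mem_comap, Ideal.mem_comap, RingHom.coe_coe, AlgHom.commutes]
    exact Ideal.mem_map_of_mem _ hx)

end Conjugation

section Hermitian

variable {k K V : Type*} [Field k] [Field K] [Algebra k K] [AddCommGroup V] [Module K V]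
  {τ : K ≃ₐ[k] K}

/-- `φ` makes `V` a Hermitian space over `K`, with respect to the involution `τ` of `K` over `k`:
`V` is finite dimensional, `φ` (linear in the first and `τ`-linear in the second variable) is
Hermitian symmetric, and `φ` is non-degenerate. -/
structure IsHermitianSpace (φ : V →ₗ[K] V →ₛₗ[(τ : K →+* K)] K) : Prop where
  finite : Module.Finite K V
  symm : ∀ v w, φ w v = τ (φ v w)
  nondegenerate : φ.Nondegenerate

/-- The Gram matrix `(φ(e_i, e_j))` of a basis. -/
def gram {ι : Type*} (φ : V →ₗ[K] V →ₛₗ[(τ : K →+* K)] K) (e : Module.Basis ι K V) :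
    Matrix ι ι K :=
  Matrix.of fun i j => φ (e i) (e j)

/-- The Hermitian determinant of `(V, φ)` is a norm: the determinant of the Gram matrix of a basis
lies in the subgroup `N(Kˣ)` of `kˣ`. (The choice of the basis does not matter, see
`detIsNorm_iff`.) -/
def DetIsNorm (φ : V →ₗ[K] V →ₛₗ[(τ : K →+* K)] K) : Prop :=
  ∃ (e : Module.Basis (Fin (Module.finrank K V)) K V) (z : Kˣ),
    (gram φ e).det = algebraMap k K (Algebra.norm k (z : K))

theorem norm_eq_mul_conj (h2 : Module.finrank k K = 2) (hτ : τ ≠ 1) (z : K) :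
    algebraMap k K (Algebra.norm k z) = z * τ z := by
  classical
  have : FiniteDimensional k K := FiniteDimensional.of_finrank_pos (by omega)
  have hle : Fintype.card (K ≃ₐ[k] K) ≤ 2 := h2 ▸ AlgEquiv.card_le
  have huniv : (Finset.univ : Finset (K ≃ₐ[k] K)) = {1, τ} := by
    symm
    apply Finset.eq_univ_of_card
    rw [Finset.card_pair hτ.symm]
    have h := Finset.card_le_univ ({1, τ} : Finset (K ≃ₐ[k] K))
    rw [Finset.card_pair hτ.symm] at h
    omega
  have hcard : Fintype.card (K ≃ₐ[k] K) = 2 := by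
    rw [← Finset.card_univ, huniv, Finset.card_pair hτ.symm]
  have : IsGalois k K := IsGalois.of_card_aut_eq_finrank k K (by
    rw [h2, Nat.card_eq_fintype_card, hcard])
  rw [Algebra.norm_eq_prod_automorphisms, huniv, Finset.prod_pair hτ.symm]
  simp

theorem det_gram_eq {ι : Type*} [Fintype ι] [DecidableEq ι]
    (φ : V →ₗ[K] V →ₛₗ[(τ : K →+* K)] K) (e e' : Module.Basis ι K V) :
    (gram φ e').det = (e.toMatrix e').det * τ (e.toMatrix e').det * (gram φ e).det := by
  have h : gram φ e' =
      (e.toMatrix e').transpose * gram φ e * (e.toMatrix e').map τ := by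
    ext i j
    have hi : e' i = ∑ x, e.toMatrix e' x i • e x := (e.sum_toMatrix_smul_self e' i).symm
    have hj : e' j = ∑ x, e.toMatrix e' x j • e x := (e.sum_toMatrix_smul_self e' j).symm
    simp only [Matrix.mul_apply, Matrix.transpose_apply, Matrix.map_apply, gram, Matrix.of_apply]
    rw [hi, hj]
    simp only [map_sum, LinearMap.map_smulₛₗ, LinearMap.sum_apply, LinearMap.smul_apply,
      smul_eq_mul, RingHom.id_apply, RingHom.coe_coe, Finset.sum_mul, Finset.mul_sum]
    refine Finset.sum_congr rfl fun x _ => Finset.sum_congr rfl fun y _ => ?_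
    ring
  have h' : ((e.toMatrix e').map τ).det = τ (e.toMatrix e').det :=
    ((τ : K →+* K).map_det (e.toMatrix e')).symm
  rw [h, Matrix.det_mul, Matrix.det_mul, Matrix.det_transpose, h']
  ring

theorem detIsNorm_iff (h2 : Module.finrank k K = 2) (hτ : τ ≠ 1)
    (φ : V →ₗ[K] V →ₛₗ[(τ : K →+* K)] K)
    (e : Module.Basis (Fin (Module.finrank K V)) K V) :
    DetIsNorm φ ↔ ∃ z : Kˣ, (gram φ e).det = algebraMap k K (Algebra.norm k (z : K)) := by
  constructor
  · rintro ⟨e', z, hz⟩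
    have hu : IsUnit (e'.toMatrix e).det := by
      have := e'.invertibleToMatrix e
      exact (Matrix.isUnit_iff_isUnit_det _).1 (isUnit_of_invertible _)
    refine ⟨hu.unit * z, ?_⟩
    rw [det_gram_eq φ e' e, hz, Units.val_mul, map_mul, map_mul, IsUnit.unit_spec,
      norm_eq_mul_conj h2 hτ (e'.toMatrix e).det]
  · rintro ⟨z, hz⟩
    exact ⟨e, z, hz⟩

/-- The unitary group `U(V)` of the `K`-linear automorphisms of `V` that preserve `φ`. -/
def unitaryGroup (φ : V →ₗ[K] V →ₛₗ[(τ : K →+* K)] K) : Subgroup (V ≃ₗ[K] V) where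
  carrier := {g | ∀ v w, φ (g v) (g w) = φ v w}
  mul_mem' := by
    intro a b ha hb v w
    rw [LinearEquiv.mul_apply, LinearEquiv.mul_apply, ha, hb]
  one_mem' := fun _ _ => rfl
  inv_mem' := by
    intro a ha v w
    have h := ha (a⁻¹ v) (a⁻¹ w)
    rw [← LinearEquiv.mul_apply, ← LinearEquiv.mul_apply, mul_inv_cancel] at h
    exact h.symm

end Hermitian

/-- A non-degenerate Hermitian form on an `R`-module `M` with values in `R / I`, with respect to an
endomorphism `σ` of `R / I`: linear in the first variable and Hermitian symmetric (hence `σ`-linear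
in the second variable), with zero radical. -/
structure IsNondegenerateHermitian {R M : Type*} [CommRing R] [AddCommGroup M] [Module R M]
    {I : Ideal R} (σ : R ⧸ I →+* R ⧸ I) (h : M → M → R ⧸ I) : Prop where
  add_left : ∀ x x' y, h (x + x') y = h x y + h x' y
  smul_left : ∀ (r : R) x y, h (r • x) y = Ideal.Quotient.mk I r * h x y
  symm : ∀ x y, h y x = σ (h x y)
  nondegenerate : ∀ x, (∀ y, h x y = 0) → x = 0

section Lattice

/- In the following definitions, `A` is the ring of integers of `k`, so that `integralClosure A K`
is the ring of integers `A_K` of `K`. -/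
variable {A k K V : Type*} [CommRing A] [Field k] [Field K] [Algebra A k] [Algebra A K]
  [Algebra k K] [IsScalarTower A k K] [AddCommGroup V] [Module K V] {τ : K ≃ₐ[k] K}

/-- A lattice in the Hermitian space `V`: a free `A_K`-submodule, of rank the dimension of `V`,
which spans `V` over `K` and on which `φ` takes values in `A_K`. -/
structure IsHermitianLattice (φ : V →ₗ[K] V →ₛₗ[(τ : K →+* K)] K)
    (L : Submodule (integralClosure A K) V) : Prop where
  finite : Module.Finite (integralClosure A K) L
  free : Module.Free (integralClosure A K) L
  rank : Module.finrank (integralClosure A K) L = Module.finrank K V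
  span : Submodule.span K (L : Set V) = ⊤
  integral : ∀ v ∈ L, ∀ w ∈ L, φ v w ∈ integralClosure A K

/-- The dual lattice `L^∨`: all vectors that pair integrally with every element of `L`. -/
def dual (φ : V →ₗ[K] V →ₛₗ[(τ : K →+* K)] K) (L : Submodule (integralClosure A K) V) :
    Submodule (integralClosure A K) V where
  carrier := {v | ∀ w ∈ L, φ v w ∈ integralClosure A K}
  add_mem' := by
    intro a b ha hb w hw
    rw [map_add, LinearMap.add_apply]
    exact add_mem (ha w hw) (hb w hw)
  zero_mem' := by
    intro w _
    rw [map_zero, LinearMap.zero_apply]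
    exact zero_mem _
  smul_mem' := by
    intro c v hv w hw
    have h : φ (c • v) w = (c : K) * φ v w := by
      rw [Subalgebra.smul_def, LinearMap.map_smul, LinearMap.smul_apply, smul_eq_mul]
    rw [h]
    exact mul_mem c.2 (hv w hw)

/-- `L` is non-degenerate, or self-dual: `L^∨ = L`. -/
def IsSelfDual (φ : V →ₗ[K] V →ₛₗ[(τ : K →+* K)] K) (L : Submodule (integralClosure A K) V) : Prop :=
  dual φ L = L

/-- The quotient module `L^∨ / L` of a lattice `L` (which lies in `L^∨`). -/
abbrev DiscQuotient (φ : V →ₗ[K] V →ₛₗ[(τ : K →+* K)] K) (L : Submodule (integralClosure A K) V) :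
    Type _ :=
  dual φ L ⧸ L.submoduleOf (dual φ L)

/-- `L^∨ / L` is a one-dimensional vector space over the residue field `A_K / π A_K`: it is
isomorphic, as an `A_K`-module, to `A_K / π A_K`. -/
def DiscIsOneDimensional [IsLocalRing A] (φ : V →ₗ[K] V →ₛₗ[(τ : K →+* K)] K)
    (L : Submodule (integralClosure A K) V) : Prop :=
  Nonempty (DiscQuotient φ L ≃ₗ[integralClosure A K] QuadResidue A K)

/-- The form `π φ` induces on `L^∨ / L` a non-degenerate Hermitian form with values in
`A_K / π A_K`. -/
def DiscIsHermitian [IsLocalRing A] (φ : V →ₗ[K] V →ₛₗ[(τ : K →+* K)] K)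
    (L : Submodule (integralClosure A K) V) (π : A) : Prop :=
  ∃ h : DiscQuotient φ L → DiscQuotient φ L → QuadResidue A K,
    (∀ x y : dual φ L, ∃ c : integralClosure A K,
      (c : K) = algebraMap A K π * φ (x : V) (y : V) ∧
      h (Submodule.Quotient.mk x) (Submodule.Quotient.mk y) = Ideal.Quotient.mk _ c) ∧
    IsNondegenerateHermitian (residueConj A τ) h

/-- `L` and `M` are conjugate under the action of the unitary group `U(V)`. -/
def UnitaryConjugate (φ : V →ₗ[K] V →ₛₗ[(τ : K →+* K)] K)
    (L M : Submodule (integralClosure A K) V) : Prop :=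
  ∃ g ∈ unitaryGroup φ, L.map (g.toLinearMap.restrictScalars (integralClosure A K)) = M

end Lattice

end

end HermitianLattices

/-!
Let `A` be the ring of integers of `k`, let `A_K` be its integral closure in `K`, and let `π` be a
uniformizer of `A`. The proof has an arithmetic part and a geometric part.

The arithmetic part extracts from the unramified extension the facts collected in
`IsUnramifiedInvolution`: `A_K` is a discrete valuation ring with uniformizer `π`, some element of
`A_K` has trace one, and every unit of `A` is the norm of an element of `A_K`. All of them come from
Hensel's lemma for quadratic polynomials and from the residue extension. That `A_K` is local holds
because an integer whose norm is divisible by `π` is itself divisible by `π`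
(`mem_map_maximalIdeal_of_norm_mem`); `τ` acts non-trivially on the residue field because `A_K` is
formally unramified over `A` (`exists_conj_sub_not_mem`), which gives the trace; and the norm is
surjective for finite fields. None of this depends on the residue characteristic.

For the geometry, take a largest orthonormal family in a lattice `L`. On its orthogonal complement
`M` in `L` no value `φ(x, x)` is a unit, for otherwise a unit multiple of `x` would have value one,
and by the trace argument of `inv_mul_apply_mem` all values of `φ` on `M` are divisible by `π`. Thus
`π⁻¹ M ⊆ L^∨`. If `L` is self-dual, then `M = π M`, and Nakayama's lemma gives `M = 0`: the lattice
has an orthonormal basis (`exists_orthonormal_basis_of_isSelfDual`). If `L^∨ / L` is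
one-dimensional, then `M` is generated by one vector, which can be chosen of value `π`
(`exists_orthogonal_basis_of_discIsOneDimensional`). Lattices with the same normal form are
conjugate. The non-degenerate Hermitian form on `L^∨ / L` is read off from the normal form
(`discIsHermitian_span`).

The same method applied to `V` gives an orthogonal basis with values one, except possibly one value
`π`, since the plane with two values `π` contains a vector of value one (`exists_orthogonal_basis`).
The determinant is `1` or `π` accordingly, and `π` is not a norm because norms have even valuation.
This decides which of the two kinds of lattice exists.
-/

open scoped ValuativeRel

namespace HermitianLattices

/-! ### Arithmetic of the unramified quadratic extension -/

section Arithmetic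

open IsLocalRing Polynomial

/-- Hensel's lemma for a quadratic polynomial with unit linear coefficient: the root that reduces to
zero. -/
theorem exists_root_mem_maximalIdeal {A : Type*} [CommRing A] [IsLocalRing A]
    [HenselianRing A (maximalIdeal A)] {t n : A} (ht : IsUnit t) (hn : n ∈ maximalIdeal A) :
    ∃ a ∈ maximalIdeal A, a ^ 2 - t * a + n = 0 := by
  have hmonic : (X ^ 2 - C t * X + C n : A[X]).Monic := by monicity!
  obtain ⟨a, ha, ha0⟩ := HenselianRing.is_henselian (I := maximalIdeal A)
    (X ^ 2 - C t * X + C n : A[X]) hmonic 0 (by simpa using hn)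
    (by simpa using ht.map (Ideal.Quotient.mk (maximalIdeal A)))
  refine ⟨a, by simpa using ha0, ?_⟩
  simpa [IsRoot.def] using ha

variable {A k K : Type*} [CommRing A] [Field k] [Field K] [Algebra A k] [Algebra A K]
  [Algebra k K] [IsScalarTower A k K] {τ : K ≃ₐ[k] K}

theorem isUnit_iff_inv_mem {A K : Type*} [CommRing A] [Field K] [Algebra A K]
    {x : integralClosure A K} (hx : x ≠ 0) :
    IsUnit x ↔ (x : K)⁻¹ ∈ integralClosure A K := by
  have hx' : (x : K) ≠ 0 := by simpa using hx
  constructor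
  · rintro ⟨u, rfl⟩
    have h : (u : K) * ((u⁻¹ : (integralClosure A K)ˣ) : integralClosure A K) = 1 :=
      congrArg Subtype.val u.mul_inv
    rw [← eq_inv_of_mul_eq_one_right h]
    exact Subtype.prop _
  · intro h
    exact IsUnit.of_mul_eq_one ⟨_, h⟩ (Subtype.ext (mul_inv_cancel₀ hx'))

theorem map_mem_integralClosure (τ : K ≃ₐ[k] K) {x : K} (hx : x ∈ integralClosure A K) :
    τ x ∈ integralClosure A K :=
  (intConj A τ ⟨x, hx⟩).2

theorem conj_conj (h2 : Module.finrank k K = 2) (hτ : τ ≠ 1) (x : K) : τ (τ x) = x := by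
  rcases eq_or_ne x 0 with rfl | hx
  · simp
  have h := congrArg τ (norm_eq_mul_conj h2 hτ x)
  rw [AlgEquiv.commutes, norm_eq_mul_conj h2 hτ, map_mul, mul_comm] at h
  exact (mul_left_cancel₀ (by simpa using hx) h).symm

theorem isGalois_of_ne_one (h2 : Module.finrank k K = 2) (hτ : τ ≠ 1) : IsGalois k K := by
  have : FiniteDimensional k K := FiniteDimensional.of_finrank_pos (by omega)
  refine IsGalois.of_card_aut_eq_finrank k K (le_antisymm ?_ ?_)
  · rw [Nat.card_eq_fintype_card]
    exact AlgEquiv.card_le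
  · rw [h2]
    have : Nontrivial (K ≃ₐ[k] K) := ⟨τ, 1, hτ⟩
    exact Finite.one_lt_card

theorem mem_range_of_conj_eq (h2 : Module.finrank k K = 2) (hτ : τ ≠ 1) {x : K} (hx : τ x = x) :
    ∃ y : k, algebraMap k K y = x := by
  have : FiniteDimensional k K := FiniteDimensional.of_finrank_pos (by omega)
  have := isGalois_of_ne_one h2 hτ
  refine (IsGalois.mem_range_algebraMap_iff_fixed x).2 fun f => ?_
  have hcard : Nat.card (K ≃ₐ[k] K) = 2 := by rw [IsGalois.card_aut_eq_finrank, h2]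
  have hf : f = 1 ∨ f = τ := by
    obtain ⟨a, b, -, hab⟩ := Nat.card_eq_two_iff.1 hcard
    have key : ∀ g : K ≃ₐ[k] K, g = a ∨ g = b := fun g => by
      have : g ∈ ({a, b} : Set (K ≃ₐ[k] K)) := hab ▸ Set.mem_univ g
      simpa using this
    rcases key f with h | h <;> rcases key 1 with h' | h' <;> rcases key τ with h'' | h'' <;>
      grind
  rcases hf with rfl | rfl
  · rfl
  · exact hx

variable [IsFractionRing A k]

theorem exists_algebraMap_of_conj_eq [IsIntegrallyClosed A] (h2 : Module.finrank k K = 2)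
    (hτ : τ ≠ 1) {x : K} (hx : x ∈ integralClosure A K) (hfix : τ x = x) :
    ∃ a : A, algebraMap A K a = x := by
  obtain ⟨y, rfl⟩ := mem_range_of_conj_eq h2 hτ hfix
  have hy : IsIntegral A y :=
    (isIntegral_algebraMap_iff (algebraMap k K).injective).1 (mem_integralClosure_iff A K |>.1 hx)
  obtain ⟨a, rfl⟩ := IsIntegrallyClosed.isIntegral_iff.1 hy
  exact ⟨a, IsScalarTower.algebraMap_apply A k K a⟩

theorem exists_trace_norm [IsIntegrallyClosed A] (h2 : Module.finrank k K = 2) (hτ : τ ≠ 1)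
    (x : integralClosure A K) :
    ∃ t n : A, algebraMap A _ t = x + intConj A τ x ∧ algebraMap A _ n = x * intConj A τ x := by
  have hxx : intConj A τ (intConj A τ x) = x := Subtype.ext (conj_conj h2 hτ (x : K))
  obtain ⟨t, ht⟩ := exists_algebraMap_of_conj_eq h2 hτ (x + intConj A τ x).2
    (congrArg Subtype.val (show intConj A τ (x + intConj A τ x) = x + intConj A τ x by
      rw [map_add, hxx, add_comm]))
  obtain ⟨n, hn⟩ := exists_algebraMap_of_conj_eq h2 hτ (x * intConj A τ x).2
    (congrArg Subtype.val (show intConj A τ (x * intConj A τ x) = x * intConj A τ x by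
      rw [map_mul, hxx, mul_comm]))
  exact ⟨t, n, Subtype.ext ht, Subtype.ext hn⟩

variable [IsDomain A] [FaithfulSMul A K]

theorem algebraMap_integralClosure_injective :
    Function.Injective (algebraMap A (integralClosure A K)) :=
  FaithfulSMul.algebraMap_injective _ _

variable [IsDiscreteValuationRing A]

theorem not_isUnit_algebraMap {ϖ : A} (hϖ : Irreducible ϖ) :
    ¬ IsUnit (algebraMap A (integralClosure A K) ϖ) := fun h =>
  hϖ.not_isUnit (isUnit_of_map_unit (algebraMap A (integralClosure A K)) ϖ h)

omit [FaithfulSMul A K] in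
theorem mem_map_maximalIdeal_iff {ϖ : A} (hϖ : Irreducible ϖ) {x : integralClosure A K} :
    x ∈ (maximalIdeal A).map (algebraMap A (integralClosure A K)) ↔ algebraMap A _ ϖ ∣ x := by
  rw [hϖ.maximalIdeal_eq, Ideal.map_span, Set.image_singleton, Ideal.mem_span_singleton]

omit [FaithfulSMul A K] in
theorem module_finite_integralClosure (h2 : Module.finrank k K = 2) (hτ : τ ≠ 1) :
    Module.Finite A (integralClosure A K) := by
  have : FiniteDimensional k K := FiniteDimensional.of_finrank_pos (by omega)
  have := isGalois_of_ne_one h2 hτ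
  exact IsIntegralClosure.finite A k K (integralClosure A K)

omit [FaithfulSMul A K] in
theorem isNoetherianRing_integralClosure (h2 : Module.finrank k K = 2) (hτ : τ ≠ 1) :
    IsNoetherianRing (integralClosure A K) :=
  have := module_finite_integralClosure (A := A) h2 hτ
  IsNoetherianRing.of_finite A _

variable [HenselianRing A (maximalIdeal A)]

/-- An integer of `K` whose norm lies in the maximal ideal `𝔪` of `A` is divisible by `𝔪`. It is a
root of `X ^ 2 - t X + n` with `n ∈ 𝔪`. If `t ∈ 𝔪`, its square vanishes in the reduced ring
`A_K / 𝔪 A_K`. If `t` is a unit, then by Hensel's lemma the polynomial splits over `A`. -/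
theorem mem_map_maximalIdeal_of_norm_mem (h2 : Module.finrank k K = 2) (hτ : τ ≠ 1)
    [Algebra.Unramified A (integralClosure A K)] {x : integralClosure A K} {n : A}
    (hn : algebraMap A _ n = x * intConj A τ x) (hn0 : n ∈ maximalIdeal A) :
    x ∈ (maximalIdeal A).map (algebraMap A (integralClosure A K)) := by
  obtain ⟨t, n', ht, hn'⟩ := exists_trace_norm h2 hτ x
  obtain rfl : n = n' := algebraMap_integralClosure_injective (hn.trans hn'.symm)
  have hx : x ^ 2 = algebraMap A _ t * x - algebraMap A _ n := by rw [ht, hn]; ring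
  by_cases htu : IsUnit t
  · obtain ⟨a, ha, hroot⟩ := exists_root_mem_maximalIdeal htu hn0
    have hfac : (x - algebraMap A _ a) * (x - algebraMap A _ (t - a)) = 0 := by
      have h0 := congrArg (algebraMap A (integralClosure A K)) hroot
      simp only [map_add, map_sub, map_mul, map_pow, map_zero] at h0 ⊢
      linear_combination hx - h0
    rcases mul_eq_zero.1 hfac with h | h
    · rw [sub_eq_zero.1 h]
      exact Ideal.mem_map_of_mem _ ha
    · exfalso
      rw [sub_eq_zero] at h
      have hunit : IsUnit (t - a) := by
        by_contra hna
        have hta := (maximalIdeal A).add_mem ((mem_maximalIdeal _).2 hna) ha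
        exact (mem_maximalIdeal t).1 (by simpa using hta) htu
      have : n = (t - a) * (t - a) := by
        apply algebraMap_integralClosure_injective (K := K)
        rw [hn, h, AlgHom.commutes, map_mul]
      exact (mem_maximalIdeal n).1 hn0 (this ▸ hunit.mul hunit)
  · refine Algebra.FormallyUnramified.isRadical_map_isMaximal (A := A)
      (B := integralClosure A K) (p := maximalIdeal A) ?_
    refine ⟨2, ?_⟩
    rw [hx]
    exact Ideal.sub_mem _ (Ideal.mul_mem_right _ _ (Ideal.mem_map_of_mem _ htu))
      (Ideal.mem_map_of_mem _ hn0)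

theorem mem_map_maximalIdeal_or_isUnit (h2 : Module.finrank k K = 2) (hτ : τ ≠ 1)
    [Algebra.Unramified A (integralClosure A K)] (x : integralClosure A K) :
    x ∈ (maximalIdeal A).map (algebraMap A (integralClosure A K)) ∨ IsUnit x := by
  obtain ⟨t, n, -, hn⟩ := exists_trace_norm h2 hτ x
  by_cases hu : IsUnit n
  · exact .inr (isUnit_of_mul_isUnit_left (hn ▸ hu.map (algebraMap A (integralClosure A K))))
  · exact .inl (mem_map_maximalIdeal_of_norm_mem h2 hτ hn hu)

theorem map_maximalIdeal_isMaximal (h2 : Module.finrank k K = 2) (hτ : τ ≠ 1)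
    [Algebra.Unramified A (integralClosure A K)] :
    ((maximalIdeal A).map (algebraMap A (integralClosure A K))).IsMaximal := by
  obtain ⟨ϖ, hϖ⟩ := IsDiscreteValuationRing.exists_irreducible A
  refine Ideal.isMaximal_def.2 ⟨fun h => ?_, fun J hJ => ?_⟩
  · exact not_isUnit_algebraMap hϖ
      (isUnit_of_dvd_one ((mem_map_maximalIdeal_iff hϖ).1 (h ▸ Submodule.mem_top)))
  · obtain ⟨x, hxJ, hx⟩ := SetLike.exists_of_lt hJ
    exact J.eq_top_of_isUnit_mem hxJ
      ((mem_map_maximalIdeal_or_isUnit (A := A) h2 hτ x).resolve_left hx)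

/-- The involution induced on `A_K / 𝔪 A_K` is not the identity: otherwise `τ` and the identity
agree modulo every power of `𝔪 A_K`, because `A_K` is formally unramified over `A`. -/
theorem exists_conj_sub_not_mem (h2 : Module.finrank k K = 2) (hτ : τ ≠ 1)
    [Algebra.Unramified A (integralClosure A K)] :
    ∃ x : integralClosure A K,
      intConj A τ x - x ∉ (maximalIdeal A).map (algebraMap A (integralClosure A K)) := by
  by_contra! h
  have := isNoetherianRing_integralClosure (A := A) h2 hτ
  have hbot := Ideal.iInf_pow_eq_bot_of_isDomain _
    (map_maximalIdeal_isMaximal (A := A) h2 hτ).ne_top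
  have hid : intConj A τ = AlgHom.id A (integralClosure A K) :=
    Algebra.FormallyUnramified.ext_of_iInf _ hbot fun x => Ideal.Quotient.eq.2 (h x)
  apply hτ
  ext x
  have := FiniteDimensional.of_finrank_pos (K := k) (V := K) (by omega)
  have : IsFractionRing (integralClosure A K) K :=
    integralClosure.isFractionRing_of_finite_extension k K
  obtain ⟨a, b, hb, rfl⟩ := IsFractionRing.div_surjective (A := integralClosure A K) x
  have key (y : integralClosure A K) : τ (y : K) = y :=
    congrArg Subtype.val (DFunLike.congr_fun hid y)
  simp only [map_div₀, AlgEquiv.one_apply]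
  exact congrArg₂ (· / ·) (key a) (key b)

/-- The trace takes the value one. It suffices that some trace is a unit: the trace of `1` if `2` is
one, and otherwise the trace of an `x` with `τ x ≢ x`, since then `x + τ x ≡ τ x - x`. -/
theorem exists_add_conj_eq_one (h2 : Module.finrank k K = 2) (hτ : τ ≠ 1)
    [Algebra.Unramified A (integralClosure A K)] :
    ∃ c : integralClosure A K, c + intConj A τ c = 1 := by
  suffices h : ∃ x : integralClosure A K,
      x + intConj A τ x ∉ (maximalIdeal A).map (algebraMap A (integralClosure A K)) by
    obtain ⟨x, hx⟩ := h
    obtain ⟨t, n, ht, -⟩ := exists_trace_norm (A := A) h2 hτ x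
    have htu : IsUnit t := by
      by_contra htu
      exact hx (ht ▸ Ideal.mem_map_of_mem _ htu)
    obtain ⟨s, hs⟩ := htu.exists_left_inv
    refine ⟨algebraMap A _ s * x, ?_⟩
    rw [map_mul, AlgHom.commutes, ← mul_add, ← ht, ← map_mul, hs, map_one]
  by_cases h1 : (2 : integralClosure A K) ∈
      (maximalIdeal A).map (algebraMap A (integralClosure A K))
  · obtain ⟨x, hx⟩ := exists_conj_sub_not_mem (A := A) h2 hτ
    refine ⟨x, fun h => hx ?_⟩
    have := Ideal.sub_mem _ h (Ideal.mul_mem_right x _ h1)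
    convert this using 1
    ring
  · exact ⟨1, by rwa [map_one, one_add_one_eq_two]⟩

/-- Every unit of `A` is a norm from `A_K` modulo `𝔪`: the norm of a quadratic extension of finite
fields is surjective. -/
theorem exists_mul_conj_sub_mem [Finite (ResidueField A)] (h2 : Module.finrank k K = 2) (hτ : τ ≠ 1)
    [Algebra.Unramified A (integralClosure A K)] (a : A) :
    ∃ z : integralClosure A K, z * intConj A τ z - algebraMap A _ a ∈
      (maximalIdeal A).map (algebraMap A (integralClosure A K)) := by
  have := map_maximalIdeal_isMaximal (A := A) h2 hτ
  have := module_finite_integralClosure (A := A) h2 hτ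
  let : Field (A ⧸ maximalIdeal A) := Ideal.Quotient.field _
  let : Field (QuadResidue A K) := Ideal.Quotient.field _
  have : Finite (A ⧸ maximalIdeal A) := ‹Finite (ResidueField A)›
  have : Module.Finite (A ⧸ maximalIdeal A) (QuadResidue A K) :=
    Module.Finite.of_restrictScalars_finite A _ _
  have : Finite (QuadResidue A K) := Module.finite_of_finite (A ⧸ maximalIdeal A)
  have hrank : Module.finrank (A ⧸ maximalIdeal A) (QuadResidue A K) = 2 := by
    have : FiniteDimensional k K := FiniteDimensional.of_finrank_pos (by omega)
    have := isGalois_of_ne_one h2 hτ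
    have := IsIntegralClosure.module_free A k K (integralClosure A K)
    rw [← h2, ← IsIntegralClosure.rank A k K (integralClosure A K)]
    exact IsLocalRing.finrank_quotient_map
  have hinv (x : QuadResidue A K) : residueConj A τ (residueConj A τ x) = x := by
    obtain ⟨x, rfl⟩ := Ideal.Quotient.mk_surjective x
    exact congrArg _ (Subtype.ext (conj_conj h2 hτ (x : K)))
  let σ : QuadResidue A K ≃ₐ[A ⧸ maximalIdeal A] QuadResidue A K :=
    AlgEquiv.ofRingEquiv (f := RingEquiv.ofRingHom (residueConj A τ) (residueConj A τ)
      (RingHom.ext hinv) (RingHom.ext hinv)) fun x => by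
        obtain ⟨x, rfl⟩ := Ideal.Quotient.mk_surjective x
        exact congrArg _ ((intConj A τ).commutes x)
  have hσ : σ ≠ 1 := by
    intro h
    obtain ⟨x, hx⟩ := exists_conj_sub_not_mem (A := A) h2 hτ
    exact hx (Ideal.Quotient.eq.1 (DFunLike.congr_fun h (Ideal.Quotient.mk _ x)))
  obtain ⟨z, hz⟩ := FiniteField.norm_surjective (A ⧸ maximalIdeal A) (QuadResidue A K)
    (Ideal.Quotient.mk _ a)
  obtain ⟨z, rfl⟩ := Ideal.Quotient.mk_surjective z
  refine ⟨z, Ideal.Quotient.eq.1 ?_⟩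
  have h := norm_eq_mul_conj hrank hσ (Ideal.Quotient.mk _ z)
  rw [hz] at h
  rw [map_mul]
  exact h.symm

/-- Every element of `1 + 𝔪` is a norm. If `c` has trace one, the norm of `1 + x c` is
`1 + x + x ^ 2 N(c)`, and Hensel's lemma provides `x`. -/
theorem exists_mul_conj_eq_of_sub_one_mem (h2 : Module.finrank k K = 2) (hτ : τ ≠ 1)
    [Algebra.Unramified A (integralClosure A K)] {a : A} (ha : a - 1 ∈ maximalIdeal A) :
    ∃ z : integralClosure A K, z * intConj A τ z = algebraMap A _ a := by
  obtain ⟨c, hc⟩ := exists_add_conj_eq_one (A := A) h2 hτ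
  obtain ⟨t, n, -, hn⟩ := exists_trace_norm (A := A) h2 hτ c
  -- `w` stands for `- n x`, so that `x = (a - 1) / (1 - w)` even when `n` is not a unit.
  obtain ⟨w, hw, hroot⟩ := exists_root_mem_maximalIdeal isUnit_one
    ((maximalIdeal A).mul_mem_left (-n) ha)
  have hu : IsUnit (1 - w) := by
    by_contra h
    have := (maximalIdeal A).add_mem ((mem_maximalIdeal _).2 h) hw
    rw [sub_add_cancel] at this
    exact (mem_maximalIdeal (1 : A)).1 this isUnit_one
  obtain ⟨s, hs⟩ := hu.exists_left_inv
  have hx : 1 + s * (a - 1) + (s * (a - 1)) ^ 2 * n = a := by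
    have hnx : n * (s * (a - 1)) = -w := by
      linear_combination (-s) * hroot - w * hs
    linear_combination s * (a - 1) * hnx + (a - 1) * hs
  refine ⟨1 + algebraMap A _ (s * (a - 1)) * c, ?_⟩
  rw [map_add, map_one, map_mul (intConj A τ), AlgHom.commutes]
  have := congrArg (algebraMap A (integralClosure A K)) hx
  rw [map_add, map_add, map_one, map_mul _ (_ ^ 2), map_pow, hn] at this
  linear_combination this + algebraMap A _ (s * (a - 1)) * hc

theorem exists_mul_conj_eq [Finite (ResidueField A)] (h2 : Module.finrank k K = 2) (hτ : τ ≠ 1)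
    [Algebra.Unramified A (integralClosure A K)] {a : A} (ha : IsUnit a) :
    ∃ z : integralClosure A K, z * intConj A τ z = algebraMap A _ a := by
  obtain ⟨z, hz⟩ := exists_mul_conj_sub_mem (A := A) h2 hτ a
  obtain ⟨t, n, -, hn⟩ := exists_trace_norm (A := A) h2 hτ z
  rw [← hn, ← map_sub] at hz
  have hna : n - a ∈ maximalIdeal A := by
    by_contra h
    have hu : IsUnit (n - a) := not_not.1 fun hu => h ((mem_maximalIdeal _).2 hu)
    exact (map_maximalIdeal_isMaximal (A := A) h2 hτ).ne_top
      (Ideal.eq_top_of_isUnit_mem _ hz (hu.map _))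
  have hnu : IsUnit n := by
    by_contra h
    have := (maximalIdeal A).sub_mem ((mem_maximalIdeal _).2 h) hna
    rw [sub_sub_cancel] at this
    exact (mem_maximalIdeal a).1 this ha
  obtain ⟨s, hs⟩ := hnu.exists_left_inv
  obtain ⟨y, hy⟩ := exists_mul_conj_eq_of_sub_one_mem (A := A) (a := s * a) h2 hτ (by
    have := (maximalIdeal A).mul_mem_left (-s) hna
    convert this using 1
    linear_combination hs)
  refine ⟨z * y, ?_⟩
  rw [map_mul, mul_mul_mul_comm, hy, ← hn, ← map_mul]
  exact congrArg _ (by linear_combination a * hs)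

/-- The properties of the ring of integers `A_K`, with its involution `τ` and its uniformizer `ϖ`,
on which the classification of lattices rests: `A_K` is a discrete valuation ring with uniformizer
`ϖ`, the trace takes the value one, and the norm maps the units of `A_K` onto the units fixed by
`τ`. Membership in `A_K` is expressed in `K`, so that a unit is an `x` with `x, x⁻¹ ∈ A_K`. The base
ring `A` enters only through `A_K` and through `A_K / 𝔪 A_K`, where `𝔪 A_K` is generated by `ϖ`. -/
structure IsUnramifiedInvolution (A : Type*) {k K : Type*} [CommRing A] [IsLocalRing A]
    [Field k] [Field K] [Algebra A K] [Algebra k K] (τ : K ≃ₐ[k] K) (ϖ : K) : Prop where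
  isNoetherianRing : IsNoetherianRing (integralClosure A K)
  ne_zero : ϖ ≠ 0
  mem : ϖ ∈ integralClosure A K
  conj_eq : τ ϖ = ϖ
  inv_notMem : ϖ⁻¹ ∉ integralClosure A K
  conj_conj : ∀ x, τ (τ x) = x
  conj_mem : ∀ x ∈ integralClosure A K, τ x ∈ integralClosure A K
  inv_mul_mem_or_inv_mem : ∀ x ∈ integralClosure A K,
    ϖ⁻¹ * x ∈ integralClosure A K ∨ x⁻¹ ∈ integralClosure A K
  mk_eq_zero_iff : ∀ c : integralClosure A K,
    (Ideal.Quotient.mk _ c : QuadResidue A K) = 0 ↔ ϖ⁻¹ * c ∈ integralClosure A K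
  exists_zpow : ∀ x ≠ 0, ∃ m : ℤ, ∃ u ∈ integralClosure A K,
    u⁻¹ ∈ integralClosure A K ∧ x = ϖ ^ m * u
  exists_trace : ∃ c ∈ integralClosure A K, c + τ c = 1
  exists_norm : ∀ u ∈ integralClosure A K, u⁻¹ ∈ integralClosure A K → τ u = u →
    ∃ z ∈ integralClosure A K, z * τ z = u

theorem isUnramifiedInvolution [Finite (ResidueField A)] (h2 : Module.finrank k K = 2)
    (hτ : τ ≠ 1) [Algebra.Unramified A (integralClosure A K)] {ϖ : A} (hϖ : Irreducible ϖ) :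
    IsUnramifiedInvolution A τ (algebraMap A K ϖ) := by
  have hnoeth := isNoetherianRing_integralClosure (A := A) h2 hτ
  have h0 : algebraMap A K ϖ ≠ 0 := by
    simpa using hϖ.ne_zero
  have hconj (a : A) : τ (algebraMap A K a) = algebraMap A K a := by
    rw [IsScalarTower.algebraMap_apply A k K, AlgEquiv.commutes]
  have hmem := (integralClosure A K).algebraMap_mem ϖ
  have hnu := not_isUnit_algebraMap (K := K) hϖ
  have hdvd (x : integralClosure A K) (h : algebraMap A _ ϖ ∣ x) :
      (algebraMap A K ϖ)⁻¹ * x ∈ integralClosure A K := by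
    obtain ⟨y, rfl⟩ := h
    change _ * (algebraMap A K ϖ * (y : K)) ∈ _
    rw [inv_mul_cancel_left₀ h0]
    exact y.2
  have hor (x : integralClosure A K) : algebraMap A _ ϖ ∣ x ∨ IsUnit x :=
    (mem_map_maximalIdeal_or_isUnit (A := A) h2 hτ x).imp_left (mem_map_maximalIdeal_iff hϖ).1
  have hdecomp (x : integralClosure A K) (hx : x ≠ 0) : ∃ m : ℕ, ∃ u : integralClosure A K,
      IsUnit u ∧ (x : K) = algebraMap A K ϖ ^ m * u := by
    obtain ⟨u, hu, hnd⟩ :=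
      (FiniteMultiplicity.of_not_isUnit hnu hx).exists_eq_pow_mul_and_not_dvd
    exact ⟨_, u, (hor u).resolve_left hnd, congrArg Subtype.val hu⟩
  refine ⟨hnoeth, h0, hmem, hconj ϖ, fun h => hnu ?_, HermitianLattices.conj_conj h2 hτ,
    fun x => map_mem_integralClosure τ, fun x hx => ?_, fun c => ?_, fun x hx => ?_,
    ?_, ?_⟩
  · exact (isUnit_iff_inv_mem (fun h => h0 (congrArg Subtype.val h))).2 h
  · rcases hor ⟨x, hx⟩ with h | h
    · exact .inl (hdvd _ h)
    · exact .inr ((isUnit_iff_inv_mem h.ne_zero).1 h)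
  · rw [Ideal.Quotient.eq_zero_iff_mem, mem_map_maximalIdeal_iff hϖ]
    exact ⟨hdvd c, fun h => ⟨⟨_, h⟩, Subtype.ext (mul_inv_cancel_left₀ h0 (c : K)).symm⟩⟩
  · have := FiniteDimensional.of_finrank_pos (K := k) (V := K) (by omega)
    have : IsFractionRing (integralClosure A K) K :=
      integralClosure.isFractionRing_of_finite_extension k K
    obtain ⟨a, b, hb, rfl⟩ := IsFractionRing.div_surjective (A := integralClosure A K) x
    have hb0 : b ≠ 0 := nonZeroDivisors.ne_zero hb
    have ha0 : a ≠ 0 := by rintro rfl; simp at hx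
    obtain ⟨m, u, hu, hau⟩ := hdecomp a ha0
    obtain ⟨l, v, hv, hbv⟩ := hdecomp b hb0
    have hu0 : (u : K) ≠ 0 := by simpa using hu.ne_zero
    have hv0 : (v : K) ≠ 0 := by simpa using hv.ne_zero
    refine ⟨m - l, u * (v : K)⁻¹, mul_mem u.2 ((isUnit_iff_inv_mem hv.ne_zero).1 hv), ?_, ?_⟩
    · rw [mul_inv, inv_inv]
      exact mul_mem ((isUnit_iff_inv_mem hu.ne_zero).1 hu) v.2
    · change (a : K) / (b : K) = _
      rw [hau, hbv, zpow_sub₀ h0, zpow_natCast, zpow_natCast]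
      field_simp
  · obtain ⟨c, hc⟩ := exists_add_conj_eq_one (A := A) h2 hτ
    exact ⟨c, c.2, congrArg Subtype.val hc⟩
  · intro u hu huinv hfix
    obtain ⟨a, rfl⟩ := exists_algebraMap_of_conj_eq h2 hτ hu hfix
    by_cases ha0 : a = 0
    · exact ⟨0, zero_mem _, by simp [ha0]⟩
    have ha : IsUnit a := isUnit_of_map_unit (algebraMap A (integralClosure A K)) a
      ((isUnit_iff_inv_mem (by simpa using ha0)).2 huinv)
    obtain ⟨z, hz⟩ := exists_mul_conj_eq h2 hτ ha
    exact ⟨z, z.2, congrArg Subtype.val hz⟩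

end Arithmetic

/-! ### Units and norms -/

namespace IsUnramifiedInvolution

variable {A k K : Type*} [CommRing A] [IsLocalRing A] [Field k] [Field K] [Algebra A K]
  [Algebra k K] {τ : K ≃ₐ[k] K} {ϖ : K}

theorem inv_mem_of_notMem (h : IsUnramifiedInvolution A τ ϖ) {x : K}
    (hx : x ∈ integralClosure A K) (hx' : ϖ⁻¹ * x ∉ integralClosure A K) :
    x⁻¹ ∈ integralClosure A K :=
  (h.inv_mul_mem_or_inv_mem x hx).resolve_left hx'

theorem nonneg_of_zpow_mem (h : IsUnramifiedInvolution A τ ϖ) {m : ℤ}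
    (hm : ϖ ^ m ∈ integralClosure A K) : 0 ≤ m := by
  by_contra hneg
  apply h.inv_notMem
  have hpow := mul_mem (pow_mem h.mem (-m - 1).toNat) hm
  rwa [← zpow_natCast, Int.toNat_of_nonneg (by omega), ← zpow_add₀ h.ne_zero,
    show -m - 1 + m = -1 by ring, zpow_neg_one] at hpow

theorem conj_zpow (h : IsUnramifiedInvolution A τ ϖ) (m : ℤ) : τ (ϖ ^ m) = ϖ ^ m := by
  rw [map_zpow₀, h.conj_eq]

/-- A nonzero element `ϖ ^ m u` of `K` fixed by `τ`, with `u` a unit, becomes a power of `ϖ`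
after multiplication by the norm of a unit. -/
theorem exists_mul_conj_mul_eq_zpow (h : IsUnramifiedInvolution A τ ϖ) {u : K} (m : ℤ)
    (hu : u ∈ integralClosure A K) (hu' : u⁻¹ ∈ integralClosure A K) (hu0 : u ≠ 0)
    (hfix : τ (ϖ ^ m * u) = ϖ ^ m * u) :
    ∃ a ∈ integralClosure A K, a⁻¹ ∈ integralClosure A K ∧ a ≠ 0 ∧
      a * τ a * (ϖ ^ m * u) = ϖ ^ m := by
  have hϖm : ϖ ^ m ≠ 0 := zpow_ne_zero _ h.ne_zero
  have hufix : τ u = u := by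
    rw [map_mul, h.conj_zpow] at hfix
    exact mul_left_cancel₀ hϖm hfix
  obtain ⟨z, hz, hzu⟩ := h.exists_norm u⁻¹ hu' (by rwa [inv_inv]) (by rw [map_inv₀, hufix])
  have hz0 : z ≠ 0 := by
    rintro rfl
    exact inv_ne_zero hu0 (by rw [← hzu, zero_mul])
  refine ⟨z, hz, ?_, hz0, ?_⟩
  · have : z⁻¹ = τ z * u := by
      rw [eq_comm]
      refine eq_inv_of_mul_eq_one_right ?_
      rw [← mul_assoc, hzu, inv_mul_cancel₀ hu0]
    rw [this]
    exact mul_mem (h.conj_mem z hz) hu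
  · rw [hzu]
    field_simp

/-- The form `c ↦ Tr(c τ(x))` takes the value one at some `c`, which is integral if `x`
is a unit. -/
theorem exists_conj_mul_add_eq_one (h : IsUnramifiedInvolution A τ ϖ) {x : K} (hx : x ≠ 0) :
    ∃ c : K, (x⁻¹ ∈ integralClosure A K → c ∈ integralClosure A K) ∧ τ c * x + c * τ x = 1 := by
  obtain ⟨c, hc, htr⟩ := h.exists_trace
  refine ⟨τ (c * x⁻¹), fun hx' => h.conj_mem _ (mul_mem hc hx'), ?_⟩
  rw [h.conj_conj, inv_mul_cancel_right₀ hx, ← map_mul, inv_mul_cancel_right₀ hx, htr]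

/-- The uniformizer is not a norm, because norms have even valuation. -/
theorem ne_mul_conj (h : IsUnramifiedInvolution A τ ϖ) {z : K} (hz : z ≠ 0) : ϖ ≠ z * τ z := by
  intro hϖ
  obtain ⟨m, u, hu, hu', rfl⟩ := h.exists_zpow z hz
  have hu0 : u ≠ 0 := right_ne_zero_of_mul hz
  have hτu0 : τ u ≠ 0 := by simpa using hu0
  rw [map_mul, h.conj_zpow] at hϖ
  have h1 : ϖ ^ (1 - 2 * m) = u * τ u := by
    rw [zpow_sub₀ h.ne_zero, two_mul, zpow_add₀ h.ne_zero, zpow_one, div_eq_iff (by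
      simpa using zpow_ne_zero m h.ne_zero)]
    linear_combination hϖ
  have h2 : ϖ ^ (2 * m - 1) = u⁻¹ * τ u⁻¹ := by
    rw [← neg_sub 1 (2 * m), zpow_neg, h1, map_inv₀, mul_inv]
  have h3 := h.nonneg_of_zpow_mem (h1 ▸ mul_mem hu (h.conj_mem u hu))
  have h4 := h.nonneg_of_zpow_mem (h2 ▸ mul_mem hu' (h.conj_mem _ hu'))
  omega

/-- Nakayama's lemma over `A_K`. -/
theorem le_of_forall_exists_add_smul (h : IsUnramifiedInvolution A τ ϖ) {V : Type*} [AddCommGroup V]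
    [Module K V] {N N' : Submodule (integralClosure A K) V} (hN : N.FG)
    (hle : ∀ x ∈ N, ∃ y ∈ N', ∃ z ∈ N, x = y + ϖ • z) : N ≤ N' := by
  refine Submodule.le_of_le_smul_of_le_jacobson_bot (I := Ideal.span {⟨ϖ, h.mem⟩}) hN ?_ ?_
  · rw [Ideal.span_singleton_le_iff_mem, Ideal.mem_jacobson_bot]
    intro y
    have hmem : ϖ * y + 1 ∈ integralClosure A K := add_mem (mul_mem h.mem y.2) (one_mem _)
    have hnot : ϖ⁻¹ * (ϖ * y + 1) ∉ integralClosure A K := by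
      rw [mul_add, inv_mul_cancel_left₀ h.ne_zero, mul_one]
      exact fun h' => h.inv_notMem (by simpa using sub_mem h' y.2)
    have h0 : ϖ * (y : K) + 1 ≠ 0 := by
      intro h0
      exact hnot (by rw [h0, mul_zero]; exact zero_mem _)
    exact (isUnit_iff_inv_mem (x := ⟨_, hmem⟩) (fun h' => h0 (congrArg Subtype.val h'))).2
      (h.inv_mem_of_notMem hmem hnot)
  · intro x hx
    obtain ⟨y, hy, z, hz, rfl⟩ := hle x hx
    have hϖz : (⟨ϖ, h.mem⟩ : integralClosure A K) • z ∈
        Ideal.span {(⟨ϖ, h.mem⟩ : integralClosure A K)} • N :=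
      Submodule.smul_mem_smul (Ideal.mem_span_singleton_self _) hz
    exact Submodule.add_mem_sup hy hϖz

end IsUnramifiedInvolution

/-! ### Orthogonal families -/

section Orthogonal

variable {k K V : Type*} [Field k] [Field K] [Algebra k K] [AddCommGroup V] [Module K V]
  {τ : K ≃ₐ[k] K} {φ : V →ₗ[K] V →ₛₗ[(τ : K →+* K)] K} {ι : Type*} {v : ι → V} {d : ι → K}

theorem apply_smul_left (φ : V →ₗ[K] V →ₛₗ[(τ : K →+* K)] K) (a : K) (x y : V) :
    φ (a • x) y = a * φ x y := by
  rw [LinearMap.map_smul, LinearMap.smul_apply, smul_eq_mul]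

theorem apply_smul_right (φ : V →ₗ[K] V →ₛₗ[(τ : K →+* K)] K) (a : K) (x y : V) :
    φ x (a • y) = τ a * φ x y := by
  rw [LinearMap.map_smulₛₗ, smul_eq_mul, RingHom.coe_coe]

theorem IsHermitianSpace.apply_eq_zero_comm (hφ : IsHermitianSpace φ) {x y : V} (h : φ x y = 0) :
    φ y x = 0 := by
  rw [hφ.symm x y, h, map_zero]

/-- The Gram matrix of the family `v` is diagonal, with diagonal `d`. -/
structure IsDiagonal (φ : V →ₗ[K] V →ₛₗ[(τ : K →+* K)] K) (v : ι → V) (d : ι → K) : Prop where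
  apply_self : ∀ i, φ (v i) (v i) = d i
  apply_of_ne : ∀ i j, i ≠ j → φ (v i) (v j) = 0

theorem IsDiagonal.cons {m : ℕ} {v : Fin m → V} {d : Fin m → K} (hv : IsDiagonal φ v d)
    (hφ : IsHermitianSpace φ) {w : V} {c : K} (hw : φ w w = c) (hwv : ∀ i, φ w (v i) = 0) :
    IsDiagonal φ (Fin.cons w v : Fin (m + 1) → V) (Fin.cons c d : Fin (m + 1) → K) where
  apply_self i := by
    cases i using Fin.cases with
    | zero => exact hw
    | succ i => exact hv.apply_self i
  apply_of_ne i j hij := by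
    cases i using Fin.cases with
    | zero =>
      cases j using Fin.cases with
      | zero => exact absurd rfl hij
      | succ j => exact hwv j
    | succ i =>
      cases j using Fin.cases with
      | zero => exact hφ.apply_eq_zero_comm (hwv i)
      | succ j => exact hv.apply_of_ne i j fun h => hij (congrArg _ h)

theorem IsDiagonal.linearIndependent (hv : IsDiagonal φ v d) (hd : ∀ i, d i ≠ 0) :
    LinearIndependent K v :=
  LinearMap.linearIndependent_of_isOrthoᵢ (B := φ) (fun i j hij => hv.apply_of_ne i j hij)
    fun i h => hd i ((hv.apply_self i).symm.trans h)

theorem IsDiagonal.apply_sum_smul [Fintype ι] (hv : IsDiagonal φ v d) (a : ι → K) (i : ι) :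
    φ (∑ j, a j • v j) (v i) = a i * d i := by
  rw [map_sum, LinearMap.sum_apply, Finset.sum_eq_single i]
  · rw [apply_smul_left, hv.apply_self]
  · intro j _ hj
    rw [apply_smul_left, hv.apply_of_ne j i hj, mul_zero]
  · intro h
    exact absurd (Finset.mem_univ i) h

/-- The component of `x` orthogonal to a finite orthogonal family `v`. -/
theorem IsDiagonal.apply_sub_sum_eq_zero [Fintype ι] (hv : IsDiagonal φ v d) (hd : ∀ i, d i ≠ 0)
    (x : V) (i : ι) : φ (x - ∑ j, (φ x (v j) / d j) • v j) (v i) = 0 := by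
  rw [map_sub, LinearMap.sub_apply, hv.apply_sum_smul, div_mul_cancel₀ _ (hd i), sub_self]

theorem IsDiagonal.repr_eq [Fintype ι] {b : Module.Basis ι K V} (hb : IsDiagonal φ b d)
    (hd : ∀ i, d i ≠ 0) (x : V) (i : ι) : b.repr x i = φ x (b i) / d i := by
  rw [eq_div_iff (hd i), ← hb.apply_sum_smul (fun j => b.repr x j), b.sum_repr]

theorem apply_eq_zero_of_forall [Fintype ι] {x : V} (hx : ∀ i, φ x (v i) = 0) (a : ι → K) :
    φ x (∑ j, a j • v j) = 0 := by
  rw [map_sum]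
  refine Finset.sum_eq_zero fun j _ => ?_
  rw [apply_smul_right, hx, mul_zero]

theorem apply_add_smul_self (hφ : IsHermitianSpace φ) (x y : V) (c : K) :
    φ (x + c • y) (x + c • y) =
      φ x x + c * τ c * φ y y + (τ c * φ x y + c * τ (φ x y)) := by
  rw [map_add (φ _), map_add φ, LinearMap.add_apply, LinearMap.add_apply, apply_smul_left,
    apply_smul_right, apply_smul_right, apply_smul_left, ← hφ.symm x y]
  ring

theorem apply_smul_self (a : K) (x : V) : φ (a • x) (a • x) = a * τ a * φ x x := by
  rw [apply_smul_left, apply_smul_right, mul_assoc]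

/-- A largest orthonormal family of vectors of `S`. -/
theorem exists_orthonormal_maximal (hφ : IsHermitianSpace φ) (S : Set V) :
    ∃ (m : ℕ) (u : Fin m → V), IsDiagonal φ u (fun _ => 1) ∧ (∀ i, u i ∈ S) ∧
      ∀ z ∈ S, (∀ i, φ z (u i) = 0) → φ z z ≠ 1 := by
  have := hφ.finite
  by_contra! hcon
  have hall : ∀ m : ℕ, ∃ u : Fin m → V, IsDiagonal φ u (fun _ => 1) ∧ ∀ i, u i ∈ S := by
    intro m
    induction m with
    | zero => exact ⟨Fin.elim0, ⟨fun i => i.elim0, fun i => i.elim0⟩, fun i => i.elim0⟩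
    | succ m ih =>
      obtain ⟨u, hu, huS⟩ := ih
      obtain ⟨z, hzS, hzu, hz⟩ := hcon m u hu huS
      refine ⟨Fin.cons z u, ?_, Fin.cases hzS huS⟩
      convert hu.cons hφ hz hzu using 1
      funext i
      cases i using Fin.cases <;> rfl
  obtain ⟨u, hu, -⟩ := hall (Module.finrank K V + 1)
  have := (hu.linearIndependent fun _ => one_ne_zero).fintype_card_le_finrank
  rw [Fintype.card_fin] at this
  omega

/-- The Hermitian determinant of a space with an orthogonal basis is the product of the values of
the form on the basis. -/
theorem IsDiagonal.detIsNorm_iff [Fintype ι] (h2 : Module.finrank k K = 2) (hτ : τ ≠ 1)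
    {b : Module.Basis ι K V} (hb : IsDiagonal φ b d) :
    DetIsNorm φ ↔ ∃ z : Kˣ, ∏ i, d i = z * τ z := by
  classical
  have hcard : Fintype.card ι = Fintype.card (Fin (Module.finrank K V)) := by
    rw [Fintype.card_fin, Module.finrank_eq_card_basis b]
  let e := Fintype.equivOfCardEq hcard
  have hgram : gram φ (b.reindex e) = Matrix.diagonal (d ∘ e.symm) := by
    ext i j
    rw [gram, Matrix.of_apply, Module.Basis.reindex_apply, Module.Basis.reindex_apply]
    rcases eq_or_ne i j with rfl | hij
    · rw [Matrix.diagonal_apply_eq, hb.apply_self, Function.comp_apply]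
    · rw [Matrix.diagonal_apply_ne _ hij, hb.apply_of_ne _ _ (by simpa using hij)]
  rw [HermitianLattices.detIsNorm_iff h2 hτ φ (b.reindex e), hgram, Matrix.det_diagonal]
  simp only [norm_eq_mul_conj h2 hτ, Function.comp_apply]
  rw [e.symm.prod_comp d]

end Orthogonal

/-! ### Lattices with an orthogonal basis -/

section OrthogonalBasis

variable {A k K V : Type*} [CommRing A] [Field k] [Field K] [Algebra A K]
  [Algebra k K] [AddCommGroup V] [Module K V] {τ : K ≃ₐ[k] K}
  {φ : V →ₗ[K] V →ₛₗ[(τ : K →+* K)] K} {ι : Type*} {d : ι → K}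

theorem smul_mem_of_mem_integralClosure (L : Submodule (integralClosure A K) V) {a : K} {x : V}
    (ha : a ∈ integralClosure A K) (hx : x ∈ L) : a • x ∈ L :=
  L.smul_mem ⟨a, ha⟩ hx

theorem sum_smul_mem [Fintype ι] (L : Submodule (integralClosure A K) V) {a : ι → K} {v : ι → V}
    (ha : ∀ i, a i ∈ integralClosure A K) (hv : ∀ i, v i ∈ L) : ∑ i, a i • v i ∈ L :=
  L.sum_mem fun i _ => smul_mem_of_mem_integralClosure L (ha i) (hv i)

namespace IsDiagonal

variable [Fintype ι] {b : Module.Basis ι K V}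

theorem mem_span_iff (hb : IsDiagonal φ b d) (hd : ∀ i, d i ≠ 0) {x : V} :
    x ∈ Submodule.span (integralClosure A K) (Set.range b) ↔
      ∀ i, φ x (b i) / d i ∈ integralClosure A K := by
  rw [b.mem_span_iff_repr_mem (integralClosure A K) x]
  refine forall_congr' fun i => ?_
  rw [hb.repr_eq hd]
  exact ⟨fun ⟨y, hy⟩ => hy ▸ y.2, fun hy => ⟨⟨_, hy⟩, rfl⟩⟩

omit [Fintype ι] in
theorem mem_dual_span_iff (hτ : ∀ x ∈ integralClosure A K, τ x ∈ integralClosure A K) {x : V} :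
    x ∈ dual φ (Submodule.span (integralClosure A K) (Set.range b)) ↔
      ∀ i, φ x (b i) ∈ integralClosure A K := by
  refine ⟨fun h i => h _ (Submodule.subset_span ⟨i, rfl⟩), fun h w hw => ?_⟩
  induction hw using Submodule.span_induction with
  | mem w hw =>
    obtain ⟨i, rfl⟩ := hw
    exact h i
  | zero => rw [map_zero]; exact zero_mem _
  | add w w' _ _ hw hw' => rw [map_add]; exact add_mem hw hw'
  | smul a w _ hw =>
    rw [Subalgebra.smul_def, apply_smul_right]
    exact mul_mem (hτ _ a.2) hw

theorem isHermitianLattice_span (hb : IsDiagonal φ b d) (hd : ∀ i, d i ≠ 0)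
    (hdmem : ∀ i, d i ∈ integralClosure A K)
    (hτ : ∀ x ∈ integralClosure A K, τ x ∈ integralClosure A K) :
    IsHermitianLattice φ (Submodule.span (integralClosure A K) (Set.range b)) where
  finite := Module.Finite.of_basis (b.restrictScalars (integralClosure A K))
  free := Module.Free.of_basis (b.restrictScalars (integralClosure A K))
  rank := by
    rw [Module.finrank_eq_card_basis (b.restrictScalars (integralClosure A K)),
      Module.finrank_eq_card_basis b]
  span := top_le_iff.1 (b.span_eq ▸ Submodule.span_mono Submodule.subset_span)
  integral := by
    intro x hx
    refine (mem_dual_span_iff hτ).2 fun i => ?_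
    rw [← div_mul_cancel₀ (φ x (b i)) (hd i)]
    exact mul_mem ((hb.mem_span_iff hd).1 hx i) (hdmem i)

/-- Lattices with orthogonal bases of the same Gram matrix are conjugate: the linear map that
carries one basis to the other preserves the form. -/
theorem unitaryConjugate_span {b' : Module.Basis ι K V} (hb : IsDiagonal φ b d)
    (hb' : IsDiagonal φ b' d) :
    UnitaryConjugate φ (Submodule.span (integralClosure A K) (Set.range b))
      (Submodule.span (integralClosure A K) (Set.range b')) := by
  let g : V ≃ₗ[K] V := b.equiv b' (Equiv.refl ι)
  have hg (i : ι) : g (b i) = b' i := b.equiv_apply i b' (Equiv.refl ι)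
  have hbasis (i j : ι) : φ (b' i) (b' j) = φ (b i) (b j) := by
    rcases eq_or_ne i j with rfl | hij
    · rw [hb.apply_self, hb'.apply_self]
    · rw [hb.apply_of_ne i j hij, hb'.apply_of_ne i j hij]
  refine ⟨g, fun x y => ?_, ?_⟩
  · conv_rhs => rw [← b.sum_repr x, ← b.sum_repr y]
    conv_lhs => rw [← b.sum_repr x, ← b.sum_repr y]
    simp only [map_sum, LinearEquiv.map_smul, hg, LinearMap.sum_apply]
    simp only [apply_smul_left, apply_smul_right, hbasis]
  · rw [Submodule.map_span, ← Set.range_comp]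
    congr 2
    funext i
    exact hg i

end IsDiagonal

/-- An orthogonal family of anisotropic vectors that generates a lattice is a basis of the space. -/
theorem IsDiagonal.exists_basis {v : ι → V} (hv : IsDiagonal φ v d) (hd : ∀ i, d i ≠ 0)
    {L : Submodule (integralClosure A K) V} (hL : IsHermitianLattice φ L) (hvL : ∀ i, v i ∈ L)
    (hle : L ≤ Submodule.span (integralClosure A K) (Set.range v)) :
    ∃ b : Module.Basis ι K V, IsDiagonal φ b d ∧
      L = Submodule.span (integralClosure A K) (Set.range b) := by
  have hspan : ⊤ ≤ Submodule.span K (Set.range v) := by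
    rw [← hL.span, Submodule.span_le]
    exact hle.trans (Submodule.span_le_restrictScalars (integralClosure A K) K (Set.range v))
  let b := Module.Basis.mk (hv.linearIndependent hd) hspan
  have hb : ⇑b = v := Module.Basis.coe_mk _ _
  refine ⟨b, by rwa [hb], ?_⟩
  rw [hb]
  exact le_antisymm hle (Submodule.span_le.2 (Set.range_subset_iff.2 hvL))

end OrthogonalBasis

/-! ### Normal forms of lattices -/

section NormalForm

variable {A k K V : Type*} [CommRing A] [IsLocalRing A] [Field k] [Field K] [Algebra A K]
  [Algebra k K] [AddCommGroup V] [Module K V] {τ : K ≃ₐ[k] K} {ϖ : K}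
  {φ : V →ₗ[K] V →ₛₗ[(τ : K →+* K)] K}

/-- A vector whose value is `ϖ ^ m` times a unit has a unit multiple of value `ϖ ^ m`. -/
theorem exists_smul_apply_self_eq_zpow (h : IsUnramifiedInvolution A τ ϖ) (hφ : IsHermitianSpace φ)
    {x : V} {m : ℤ} {u : K} (hu : u ∈ integralClosure A K) (hu' : u⁻¹ ∈ integralClosure A K)
    (hu0 : u ≠ 0) (hx : φ x x = ϖ ^ m * u) :
    ∃ a ∈ integralClosure A K, a⁻¹ ∈ integralClosure A K ∧ a ≠ 0 ∧
      φ (a • x) (a • x) = ϖ ^ m := by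
  obtain ⟨a, ha, ha', ha0, hax⟩ := h.exists_mul_conj_mul_eq_zpow m hu hu' hu0
    (by rw [← hx, ← hφ.symm])
  exact ⟨a, ha, ha', ha0, by rw [apply_smul_self, hx, hax]⟩

/-- An integral Hermitian module in which no vector has value one has all its values in `ϖ A_K`.
For the values `φ(x, x)` this holds as the norm of units is surjective. If `φ(x, y)` were a unit,
then, the trace being surjective, `φ(x + c y, x + c y)` would be a unit for a suitable `c`. -/
theorem inv_mul_apply_mem (h : IsUnramifiedInvolution A τ ϖ) (hφ : IsHermitianSpace φ)
    {N : Submodule (integralClosure A K) V}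
    (hint : ∀ x ∈ N, ∀ y ∈ N, φ x y ∈ integralClosure A K) (hone : ∀ x ∈ N, φ x x ≠ 1)
    {x y : V} (hx : x ∈ N) (hy : y ∈ N) : ϖ⁻¹ * φ x y ∈ integralClosure A K := by
  have hself : ∀ z ∈ N, ϖ⁻¹ * φ z z ∈ integralClosure A K := by
    intro z hz
    by_contra hnot
    have hz0 : φ z z ≠ 0 := by
      intro h0
      exact hnot (by rw [h0, mul_zero]; exact zero_mem _)
    obtain ⟨a, ha, -, -, haz⟩ := exists_smul_apply_self_eq_zpow (m := 0) h hφ (hint z hz z hz)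
      (h.inv_mem_of_notMem (hint z hz z hz) hnot) hz0 (by rw [zpow_zero, one_mul])
    exact hone _ (smul_mem_of_mem_integralClosure N ha hz) (by rw [haz, zpow_zero])
  by_contra hnot
  have hxy0 : φ x y ≠ 0 := by
    intro h0
    exact hnot (by rw [h0, mul_zero]; exact zero_mem _)
  obtain ⟨c, hc, htr⟩ := h.exists_conj_mul_add_eq_one hxy0
  have hc := hc (h.inv_mem_of_notMem (hint x hx y hy) hnot)
  have hz := hself _ (add_mem hx (smul_mem_of_mem_integralClosure N hc hy))
  rw [apply_add_smul_self hφ, htr] at hz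
  apply h.inv_notMem
  have h1 := sub_mem (sub_mem hz (hself x hx))
    (mul_mem (mul_mem hc (h.conj_mem c hc)) (hself y hy))
  convert h1 using 1
  ring

/-- The submodule of the vectors of `L` that are orthogonal to the family `u`. -/
def orthogonalIn {ι : Type*} (φ : V →ₗ[K] V →ₛₗ[(τ : K →+* K)] K)
    (L : Submodule (integralClosure A K) V) (u : ι → V) : Submodule (integralClosure A K) V where
  carrier := {x | x ∈ L ∧ ∀ i, φ x (u i) = 0}
  add_mem' := fun hx hy => ⟨add_mem hx.1 hy.1, fun i => by
    rw [map_add, LinearMap.add_apply, hx.2, hy.2, add_zero]⟩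
  zero_mem' := ⟨zero_mem _, fun i => by rw [map_zero, LinearMap.zero_apply]⟩
  smul_mem' := fun a x hx => ⟨L.smul_mem a hx.1, fun i => by
    rw [Subalgebra.smul_def, apply_smul_left, hx.2, mul_zero]⟩

theorem IsDiagonal.apply_sub_sum_apply_smul {ι : Type*} [Fintype ι] {u : ι → V}
    (hu : IsDiagonal φ u fun _ => 1) (x : V) (i : ι) :
    φ (x - ∑ j, φ x (u j) • u j) (u i) = 0 := by
  simpa using hu.apply_sub_sum_eq_zero (fun _ => one_ne_zero) x i

omit [IsLocalRing A] in
theorem sub_sum_mem_orthogonalIn {ι : Type*} [Fintype ι] {u : ι → V}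
    {L : Submodule (integralClosure A K) V} (hL : IsHermitianLattice φ L)
    (hu : IsDiagonal φ u fun _ => 1) (huL : ∀ i, u i ∈ L) {x : V} (hx : x ∈ L) :
    x - ∑ i, φ x (u i) • u i ∈ orthogonalIn φ L u :=
  ⟨sub_mem hx (sum_smul_mem L (fun i => hL.integral x hx _ (huL i)) huL),
    hu.apply_sub_sum_apply_smul x⟩

/-- For a largest orthonormal family `u` in `L`, the vectors `ϖ⁻¹ x` with `x ∈ L` orthogonal to `u`
lie in the dual lattice. -/
theorem inv_smul_mem_dual {ι : Type*} [Fintype ι] {u : ι → V} (h : IsUnramifiedInvolution A τ ϖ)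
    (hφ : IsHermitianSpace φ) {L : Submodule (integralClosure A K) V} (hL : IsHermitianLattice φ L)
    (hu : IsDiagonal φ u fun _ => 1) (huL : ∀ i, u i ∈ L)
    (hmax : ∀ z ∈ L, (∀ i, φ z (u i) = 0) → φ z z ≠ 1) {x : V} (hx : x ∈ orthogonalIn φ L u) :
    ϖ⁻¹ • x ∈ dual φ L := by
  intro w hw
  have key := inv_mul_apply_mem h hφ (N := orthogonalIn φ L u)
    (fun x hx y hy => hL.integral x hx.1 y hy.1) (fun z hz => hmax z hz.1 hz.2) hx
    (sub_sum_mem_orthogonalIn hL hu huL hw)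
  rwa [map_sub, apply_eq_zero_of_forall hx.2, sub_zero, ← apply_smul_left] at key

theorem orthogonalIn_fg (h : IsUnramifiedInvolution A τ ϖ) {ι : Type*} {u : ι → V}
    {L : Submodule (integralClosure A K) V} (hL : IsHermitianLattice φ L) :
    (orthogonalIn φ L u).FG :=
  have := h.isNoetherianRing
  Submodule.FG.of_le (Module.Finite.iff_fg.1 hL.finite) fun _ hx => hx.1

/-- A self-dual lattice has an orthonormal basis. For a largest orthonormal family `u` in `L`, the
vectors of `L` orthogonal to `u` are divisible by `ϖ` in `L`, hence vanish by Nakayama's lemma. -/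
theorem exists_orthonormal_basis_of_isSelfDual (h : IsUnramifiedInvolution A τ ϖ)
    (hφ : IsHermitianSpace φ) {L : Submodule (integralClosure A K) V} (hL : IsHermitianLattice φ L)
    (hself : IsSelfDual φ L) :
    ∃ (m : ℕ) (b : Module.Basis (Fin m) K V), IsDiagonal φ b (fun _ => 1) ∧
      L = Submodule.span (integralClosure A K) (Set.range b) := by
  obtain ⟨m, u, hu, huL, hmax⟩ := exists_orthonormal_maximal hφ (L : Set V)
  have hbot : orthogonalIn φ L u ≤ ⊥ := by
    refine h.le_of_forall_exists_add_smul (orthogonalIn_fg h hL) fun x hx => ?_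
    refine ⟨0, zero_mem _, ϖ⁻¹ • x, ⟨?_, fun i => ?_⟩, ?_⟩
    · rw [← show dual φ L = L from hself]
      exact inv_smul_mem_dual h hφ hL hu huL hmax hx
    · rw [apply_smul_left, hx.2, mul_zero]
    · rw [smul_inv_smul₀ h.ne_zero, zero_add]
  refine ⟨m, hu.exists_basis (fun _ => one_ne_zero) hL huL fun x hx => ?_⟩
  rw [sub_eq_zero.1 ((Submodule.mem_bot _).1 (hbot (sub_sum_mem_orthogonalIn hL hu huL hx)))]
  exact sum_smul_mem _ (fun i => hL.integral x hx _ (huL i)) fun i => Submodule.subset_span ⟨i, rfl⟩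

theorem map_smul_eq_mk_mul {R M : Type*} [CommRing R] [AddCommGroup M] [Module R M] {I : Ideal R}
    (e : M ≃ₗ[R] R ⧸ I) (r : R) (x : M) : e (r • x) = Ideal.Quotient.mk I r * e x := by
  rw [e.map_smul, Algebra.smul_def, Ideal.Quotient.algebraMap_eq]

theorem smul_mem_of_discIsOneDimensional (h : IsUnramifiedInvolution A τ ϖ)
    {L : Submodule (integralClosure A K) V} (hdisc : DiscIsOneDimensional φ L) {x : V}
    (hx : x ∈ dual φ L) : ϖ • x ∈ L := by
  obtain ⟨e⟩ := hdisc
  have h0 : (⟨ϖ, h.mem⟩ : integralClosure A K) •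
      (Submodule.Quotient.mk ⟨x, hx⟩ : DiscQuotient φ L) = 0 := by
    apply e.injective
    rw [map_smul_eq_mk_mul, e.map_zero,
      (h.mk_eq_zero_iff ⟨ϖ, h.mem⟩).2 (by rw [inv_mul_cancel₀ h.ne_zero]; exact one_mem _),
      zero_mul]
  rw [← Submodule.Quotient.mk_smul, Submodule.Quotient.mk_eq_zero] at h0
  exact h0

theorem exists_mem_dual_notMem (h : IsUnramifiedInvolution A τ ϖ)
    {L : Submodule (integralClosure A K) V} (hdisc : DiscIsOneDimensional φ L) :
    ∃ x ∈ dual φ L, x ∉ L := by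
  obtain ⟨e⟩ := hdisc
  obtain ⟨x, hx⟩ := Submodule.Quotient.mk_surjective _ (e.symm 1)
  refine ⟨x, x.2, fun hxL => ?_⟩
  have h0 : (Submodule.Quotient.mk x : DiscQuotient φ L) = 0 :=
    (Submodule.Quotient.mk_eq_zero _).2 hxL
  rw [hx, LinearEquiv.map_eq_zero_iff, ← map_one (Ideal.Quotient.mk _), h.mk_eq_zero_iff] at h0
  exact h.inv_notMem (by simpa using h0)

theorem exists_sub_smul_mem (h : IsUnramifiedInvolution A τ ϖ)
    {L : Submodule (integralClosure A K) V} (hdisc : DiscIsOneDimensional φ L) {x y : V}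
    (hx : x ∈ dual φ L) (hxL : x ∉ L) (hy : y ∈ dual φ L) :
    ∃ a ∈ integralClosure A K, y - a • x ∈ L := by
  obtain ⟨e⟩ := hdisc
  obtain ⟨c, hc⟩ := Ideal.Quotient.mk_surjective (e (Submodule.Quotient.mk ⟨x, hx⟩))
  obtain ⟨c', hc'⟩ := Ideal.Quotient.mk_surjective (e (Submodule.Quotient.mk ⟨y, hy⟩))
  have hcnot : ϖ⁻¹ * (c : K) ∉ integralClosure A K := by
    rw [← h.mk_eq_zero_iff, hc, LinearEquiv.map_eq_zero_iff, Submodule.Quotient.mk_eq_zero]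
    exact hxL
  have hc0 : (c : K) ≠ 0 := by
    intro h0
    exact hcnot (by rw [h0, mul_zero]; exact zero_mem _)
  have hcinv := h.inv_mem_of_notMem c.2 hcnot
  let a : integralClosure A K := c' * ⟨_, hcinv⟩
  have hac : a * c = c' := Subtype.ext (inv_mul_cancel_right₀ hc0 (c' : K))
  refine ⟨a, a.2, ?_⟩
  have h0 : (Submodule.Quotient.mk ⟨y, hy⟩ : DiscQuotient φ L) =
      Submodule.Quotient.mk (a • ⟨x, hx⟩) := by
    apply e.injective
    rw [Submodule.Quotient.mk_smul, map_smul_eq_mk_mul, ← hc, ← hc', ← map_mul, hac]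
  have hsub := (Submodule.Quotient.eq _).1 h0
  exact hsub

/-- A lattice with one-dimensional `L^∨ / L` has an orthogonal basis in which one vector has value
`ϖ` and the others have value one. For a largest orthonormal family `u` in `L`, the module of the
vectors of `L` orthogonal to `u` is generated by one vector `m₀`, by Nakayama's lemma. The value of
`m₀` is divisible by `ϖ`, and not by `ϖ ^ 2` because `ϖ L^∨ ⊆ L`. -/
theorem exists_orthogonal_basis_of_discIsOneDimensional (h : IsUnramifiedInvolution A τ ϖ)
    (hφ : IsHermitianSpace φ) {L : Submodule (integralClosure A K) V} (hL : IsHermitianLattice φ L)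
    (hdisc : DiscIsOneDimensional φ L) :
    ∃ (m : ℕ) (b : Module.Basis (Fin (m + 1)) K V),
      IsDiagonal φ b (Fin.cons ϖ fun _ => 1) ∧
      L = Submodule.span (integralClosure A K) (Set.range b) := by
  obtain ⟨m, u, hu, huL, hmax⟩ := exists_orthonormal_maximal hφ (L : Set V)
  have hϖ0 := h.ne_zero
  -- the generator `m₀ = ϖ y` comes from a vector `y` of the dual lattice that is not in `L`
  obtain ⟨x₀, hx₀, hx₀L⟩ := exists_mem_dual_notMem h hdisc
  set y := x₀ - ∑ i, φ x₀ (u i) • u i with hy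
  have hsum : ∑ i, φ x₀ (u i) • u i ∈ L := sum_smul_mem L (fun i => hx₀ _ (huL i)) huL
  have hydual : y ∈ dual φ L := sub_mem hx₀ (hL.integral _ hsum)
  have hyL : y ∉ L := fun hyL => hx₀L (by simpa [hy] using add_mem hyL hsum)
  have hyu : ∀ i, φ y (u i) = 0 := hu.apply_sub_sum_apply_smul x₀
  have hm₀ : ϖ • y ∈ orthogonalIn φ L u :=
    ⟨smul_mem_of_discIsOneDimensional h hdisc hydual, fun i => by
      rw [apply_smul_left, hyu, mul_zero]⟩
  have hcyclic : orthogonalIn φ L u ≤ Submodule.span (integralClosure A K) {ϖ • y} := by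
    refine h.le_of_forall_exists_add_smul (orthogonalIn_fg h hL) fun x hx => ?_
    obtain ⟨a, ha, hal⟩ :=
      exists_sub_smul_mem h hdisc hydual hyL (inv_smul_mem_dual h hφ hL hu huL hmax hx)
    refine ⟨a • ϖ • y, smul_mem_of_mem_integralClosure _ ha (Submodule.mem_span_singleton_self _),
      _, ⟨hal, fun i => ?_⟩, ?_⟩
    · rw [map_sub, LinearMap.sub_apply, apply_smul_left, apply_smul_left, hx.2, hyu, mul_zero,
        mul_zero, sub_zero]
    · rw [smul_sub ϖ (ϖ⁻¹ • x), smul_inv_smul₀ hϖ0, smul_comm ϖ a y, add_sub_cancel]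
  have hmem_cyclic {x : V} (hx : x ∈ orthogonalIn φ L u) :
      ∃ a ∈ integralClosure A K, x = a • ϖ • y := by
    obtain ⟨a, rfl⟩ := Submodule.mem_span_singleton.1 (hcyclic hx)
    exact ⟨a, a.2, rfl⟩
  have hq : φ y (ϖ • y) ∈ integralClosure A K := hydual _ hm₀.1
  have hqnot : ϖ⁻¹ * φ y (ϖ • y) ∉ integralClosure A K := by
    intro hmem
    apply hyL
    rw [← smul_inv_smul₀ hϖ0 y]
    refine smul_mem_of_discIsOneDimensional h hdisc fun w hw => ?_
    obtain ⟨a, ha, hwa⟩ := hmem_cyclic (sub_sum_mem_orthogonalIn hL hu huL hw)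
    rw [sub_eq_iff_eq_add.1 hwa, map_add, apply_smul_left, apply_smul_left,
      apply_eq_zero_of_forall hyu, mul_zero, add_zero, apply_smul_right, mul_left_comm]
    exact mul_mem (h.conj_mem a ha) hmem
  have hq0 : φ y (ϖ • y) ≠ 0 := by
    intro h0
    exact hqnot (by rw [h0, mul_zero]; exact zero_mem _)
  obtain ⟨a, ha, hainv, ha0, hval⟩ := exists_smul_apply_self_eq_zpow (x := ϖ • y) (m := 1) h hφ hq
    (h.inv_mem_of_notMem hq hqnot) hq0 (by rw [apply_smul_left, zpow_one])
  have hdiag := hu.cons hφ hval fun i => by rw [apply_smul_left, hm₀.2, mul_zero]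
  rw [zpow_one] at hdiag
  refine ⟨m, hdiag.exists_basis (Fin.cases hϖ0 fun _ => one_ne_zero) hL
    (Fin.cases (smul_mem_of_mem_integralClosure L ha hm₀.1) huL) fun x hx => ?_⟩
  obtain ⟨c, hc, hxc⟩ := hmem_cyclic (sub_sum_mem_orthogonalIn hL hu huL hx)
  rw [sub_eq_iff_eq_add.1 hxc]
  refine add_mem ?_ (sum_smul_mem _ (fun i => hL.integral x hx _ (huL i)) fun i =>
    Submodule.subset_span ⟨i.succ, rfl⟩)
  have : c • ϖ • y = (c * a⁻¹) • a • ϖ • y := by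
    rw [mul_smul, inv_smul_smul₀ ha0]
  rw [this]
  exact smul_mem_of_mem_integralClosure _ (mul_mem hc hainv) (Submodule.subset_span ⟨0, rfl⟩)

end NormalForm

/-! ### The discriminant form -/

section Discriminant

variable {A k K V : Type*} [CommRing A] [IsLocalRing A] [Field k] [Field K] [Algebra A K]
  [Algebra k K] [AddCommGroup V] [Module K V] {τ : K ≃ₐ[k] K} {ϖ : K}
  {φ : V →ₗ[K] V →ₛₗ[(τ : K →+* K)] K}

theorem nonempty_quotient_linearEquiv {R M : Type*} [CommRing R] [AddCommGroup M] [Module R M]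
    {I : Ideal R} {N : Submodule R M} (f : M →ₗ[R] R) (hf : Function.Surjective f)
    (hN : ∀ x, x ∈ N ↔ Ideal.Quotient.mk I (f x) = 0) : Nonempty ((M ⧸ N) ≃ₗ[R] R ⧸ I) := by
  have hker : N = LinearMap.ker ((Algebra.linearMap R (R ⧸ I)).comp f) := by
    ext x
    exact hN x
  exact ⟨(Submodule.quotEquivOfEq _ _ hker).trans (LinearMap.quotKerEquivOfSurjective _
    (Ideal.Quotient.mk_surjective.comp hf))⟩

/-- `L^∨ / L` is identified with `A_K / π A_K` by pairing with the basis vector of value `ϖ`. -/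
theorem discIsOneDimensional_span (h : IsUnramifiedInvolution A τ ϖ) {m : ℕ}
    {b : Module.Basis (Fin (m + 1)) K V} (hb : IsDiagonal φ b (Fin.cons ϖ fun _ => 1)) :
    DiscIsOneDimensional φ (Submodule.span (integralClosure A K) (Set.range b)) := by
  set L := Submodule.span (integralClosure A K) (Set.range b)
  have hd : ∀ i, (Fin.cons ϖ fun _ => 1 : Fin (m + 1) → K) i ≠ 0 :=
    Fin.cases h.ne_zero fun _ => one_ne_zero
  have hdual {x : V} : x ∈ dual φ L ↔ ∀ i, φ x (b i) ∈ integralClosure A K :=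
    IsDiagonal.mem_dual_span_iff h.conj_mem
  let ψ : dual φ L →ₗ[integralClosure A K] integralClosure A K :=
    { toFun := fun x => ⟨φ x (b 0), hdual.1 x.2 0⟩
      map_add' := fun x y => Subtype.ext (LinearMap.congr_fun (map_add φ (x : V) y) (b 0))
      map_smul' := fun a x => Subtype.ext (apply_smul_left φ (a : K) (x : V) (b 0)) }
  have hsurj : Function.Surjective ψ := by
    intro c
    have hval : φ ((c * ϖ⁻¹ : K) • b 0) (b 0) = c := by
      rw [apply_smul_left, hb.apply_self, Fin.cons_zero, inv_mul_cancel_right₀ h.ne_zero]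
    refine ⟨⟨(c * ϖ⁻¹ : K) • b 0, hdual.2 fun i => ?_⟩, Subtype.ext hval⟩
    rcases eq_or_ne i 0 with rfl | hi
    · rw [hval]
      exact c.2
    · rw [apply_smul_left, hb.apply_of_ne 0 i hi.symm, mul_zero]
      exact zero_mem _
  refine nonempty_quotient_linearEquiv ψ hsurj fun x => ?_
  refine (hb.mem_span_iff hd).trans (Iff.trans ⟨fun hx => ?_, fun hx => ?_⟩
    (h.mk_eq_zero_iff _).symm)
  · have := hx 0
    rwa [Fin.cons_zero, div_eq_inv_mul] at this
  · refine Fin.cases ?_ fun i => ?_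
    · rw [Fin.cons_zero, div_eq_inv_mul]
      exact hx
    · rw [Fin.cons_succ, div_one]
      exact hdual.1 x.2 _

variable [Algebra A k] [IsScalarTower A k K]

/-- If `π L^∨ ⊆ L`, the form `π φ` induces a non-degenerate Hermitian form on `L^∨ / L`. The radical
vanishes because `L` is the dual of `L^∨`, as its orthogonal basis shows. -/
theorem discIsHermitian_span {π : A} (h : IsUnramifiedInvolution A τ (algebraMap A K π))
    (hφ : IsHermitianSpace φ) {ι : Type*} [Fintype ι] {d : ι → K} {b : Module.Basis ι K V}
    (hb : IsDiagonal φ b d) (hd : ∀ i, d i ≠ 0)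
    (hπ : ∀ x ∈ dual φ (Submodule.span (integralClosure A K) (Set.range b)),
      algebraMap A K π • x ∈ Submodule.span (integralClosure A K) (Set.range b)) :
    DiscIsHermitian φ (Submodule.span (integralClosure A K) (Set.range b)) π := by
  set L := Submodule.span (integralClosure A K) (Set.range b)
  have hdual {x : V} : x ∈ dual φ L ↔ ∀ i, φ x (b i) ∈ integralClosure A K :=
    IsDiagonal.mem_dual_span_iff h.conj_mem
  have hint (x y : dual φ L) : algebraMap A K π * φ (x : V) (y : V) ∈ integralClosure A K := by
    rw [← apply_smul_left, hφ.symm y]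
    exact h.conj_mem _ (y.2 _ (hπ x x.2))
  let f (x y : dual φ L) : integralClosure A K := ⟨_, hint x y⟩
  let F (x y : dual φ L) : QuadResidue A K := Ideal.Quotient.mk _ (f x y)
  have hFadd (x x' y : dual φ L) : F (x + x') y = F x y + F x' y := by
    refine (congrArg (Ideal.Quotient.mk _) (?_ : f (x + x') y = f x y + f x' y)).trans
      (map_add _ _ _)
    refine Subtype.ext ?_
    change _ * φ (x + x' : V) y = _ * φ (x : V) y + _ * φ (x' : V) y
    rw [map_add, LinearMap.add_apply, mul_add]
  have hFsmul (a : integralClosure A K) (x y : dual φ L) :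
      F (a • x) y = Ideal.Quotient.mk _ a * F x y := by
    refine (congrArg (Ideal.Quotient.mk _) (?_ : f (a • x) y = a * f x y)).trans
      (map_mul _ _ _)
    refine Subtype.ext ?_
    change _ * φ ((a : K) • (x : V)) y = (a : K) * (_ * φ (x : V) y)
    rw [apply_smul_left, mul_left_comm]
  have hFsymm (x y : dual φ L) : F y x = residueConj A τ (F x y) := by
    refine congrArg (Ideal.Quotient.mk _) (Subtype.ext ?_)
    change _ * φ (y : V) x = τ (_ * φ (x : V) y)
    rw [map_mul, h.conj_eq, hφ.symm x y]
  have hFzero (x y : dual φ L) : F x y = 0 ↔ φ (x : V) (y : V) ∈ integralClosure A K := by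
    refine (h.mk_eq_zero_iff _).trans ?_
    rw [show (f x y : K) = algebraMap A K π * φ (x : V) (y : V) from rfl,
      inv_mul_cancel_left₀ h.ne_zero]
  have hFleft {x x' : dual φ L} (hx : (Submodule.Quotient.mk x : DiscQuotient φ L) =
      Submodule.Quotient.mk x') (y : dual φ L) : F x y = F x' y := by
    have hsub := (Submodule.Quotient.eq _).1 hx
    have hmem : (x - x' : V) ∈ L := hsub
    have h0 : F (x - x') y = 0 := by
      rw [hFzero, hφ.symm y]
      exact h.conj_mem _ (y.2 _ hmem)
    rw [← sub_add_cancel x x', hFadd, h0, zero_add]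
  let r : DiscQuotient φ L → dual φ L := Function.surjInv (Submodule.Quotient.mk_surjective _)
  have hr (x : DiscQuotient φ L) : Submodule.Quotient.mk (r x) = x := Function.surjInv_eq _ x
  have hspec (x y : dual φ L) :
      F (r (Submodule.Quotient.mk x)) (r (Submodule.Quotient.mk y)) = F x y := by
    rw [hFleft (hr _), hFsymm, hFleft (hr _), ← hFsymm]
  refine ⟨fun x y => F (r x) (r y), fun x y => ⟨f x y, rfl, hspec x y⟩, ?_, ?_, ?_, ?_⟩
  · intro x x' y
    rw [← hFadd]
    exact hFleft (by rw [hr, Submodule.Quotient.mk_add, hr, hr]) _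
  · intro a x y
    rw [← hFsmul]
    exact hFleft (by rw [hr, Submodule.Quotient.mk_smul, hr]) _
  · intro x y
    exact hFsymm _ _
  · intro x hx
    rw [← hr x, Submodule.Quotient.mk_eq_zero, Submodule.submoduleOf, Submodule.mem_comap,
      Submodule.subtype_apply]
    refine (hb.mem_span_iff hd).2 fun i => ?_
    have hmem : (d i)⁻¹ • b i ∈ dual φ L := by
      refine hdual.2 fun j => ?_
      rw [apply_smul_left]
      rcases eq_or_ne i j with rfl | hij
      · rw [hb.apply_self, inv_mul_cancel₀ (hd i)]
        exact one_mem _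
      · rw [hb.apply_of_ne i j hij, mul_zero]
        exact zero_mem _
    have h0 : F (r x) ⟨_, hmem⟩ = 0 := by
      have := hx (Submodule.Quotient.mk ⟨_, hmem⟩)
      rwa [hFsymm, hFleft (hr _), ← hFsymm] at this
    rw [hFzero, apply_smul_right, map_inv₀, ← hb.apply_self, ← hφ.symm, hb.apply_self] at h0
    rwa [div_eq_inv_mul]

end Discriminant

/-! ### Normal forms of Hermitian spaces -/

section Space

variable {A k K V : Type*} [CommRing A] [IsLocalRing A] [Field k] [Field K] [Algebra A K]
  [Algebra k K] [AddCommGroup V] [Module K V] {τ : K ≃ₐ[k] K} {ϖ : K}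
  {φ : V →ₗ[K] V →ₛₗ[(τ : K →+* K)] K} {ι : Type*} {v : ι → V} {d : ι → K}

/-- The orthogonal complement of an anisotropic orthogonal family that does not span is a nonzero
non-degenerate space, hence contains an anisotropic vector. -/
theorem exists_orthogonal_apply_self_ne_zero [Fintype ι] (h : IsUnramifiedInvolution A τ ϖ)
    (hφ : IsHermitianSpace φ) (hv : IsDiagonal φ v d) (hd : ∀ i, d i ≠ 0)
    (hspan : ¬ ⊤ ≤ Submodule.span K (Set.range v)) :
    ∃ w, (∀ i, φ w (v i) = 0) ∧ φ w w ≠ 0 := by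
  by_contra! hcon
  obtain ⟨x, -, hx⟩ := Set.not_subset.1 hspan
  set x' := x - ∑ j, (φ x (v j) / d j) • v j with hx'
  have hxv : ∀ i, φ x' (v i) = 0 := hv.apply_sub_sum_eq_zero hd x
  have hx0 : x' ≠ 0 := by
    intro h0
    rw [hx', sub_eq_zero] at h0
    rw [h0] at hx
    exact hx (Submodule.sum_mem _ fun i _ =>
      Submodule.smul_mem _ _ (Submodule.subset_span ⟨i, rfl⟩))
  obtain ⟨y, hy⟩ : ∃ y, φ x' y ≠ 0 := by
    by_contra! h0
    exact hx0 (hφ.nondegenerate.1 x' h0)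
  set y' := y - ∑ j, (φ y (v j) / d j) • v j with hy'
  have hyv : ∀ i, φ y' (v i) = 0 := hv.apply_sub_sum_eq_zero hd y
  have hxy : φ x' y' ≠ 0 := by
    rwa [hy', map_sub, apply_eq_zero_of_forall hxv, sub_zero]
  obtain ⟨c, -, htr⟩ := h.exists_conj_mul_add_eq_one hxy
  have h1 := hcon (x' + c • y') fun i => by
    rw [map_add, LinearMap.add_apply, apply_smul_left, hxv, hyv, mul_zero, add_zero]
  rw [apply_add_smul_self hφ, htr, hcon x' hxv, hcon y' hyv, mul_zero, add_zero, zero_add] at h1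
  exact one_ne_zero h1

theorem exists_smul_apply_self_eq_one_or (h : IsUnramifiedInvolution A τ ϖ)
    (hφ : IsHermitianSpace φ) {w : V} (hw : φ w w ≠ 0) :
    ∃ a : K, φ (a • w) (a • w) = 1 ∨ φ (a • w) (a • w) = ϖ := by
  obtain ⟨m, u, hu, hu', hwu⟩ := h.exists_zpow _ hw
  obtain ⟨a, -, -, -, ha⟩ := exists_smul_apply_self_eq_zpow h hφ hu hu'
    (right_ne_zero_of_mul (hwu ▸ hw)) hwu
  obtain ⟨j, rfl | rfl⟩ := m.even_or_odd'
  · refine ⟨ϖ ^ (-j) * a, .inl ?_⟩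
    rw [mul_smul, apply_smul_self, ha, h.conj_zpow, ← zpow_add₀ h.ne_zero, ← zpow_add₀ h.ne_zero,
      show -j + -j + 2 * j = 0 by ring, zpow_zero]
  · refine ⟨ϖ ^ (-j) * a, .inr ?_⟩
    rw [mul_smul, apply_smul_self, ha, h.conj_zpow, ← zpow_add₀ h.ne_zero, ← zpow_add₀ h.ne_zero,
      show -j + -j + (2 * j + 1) = 1 by ring, zpow_one]

/-- Two orthogonal vectors of value `ϖ` span a plane that contains a vector of value one: if
`N(x) = ϖ - 1`, the vector `ϖ⁻¹ (x w + w')` has the value `ϖ⁻² (ϖ (ϖ - 1) + ϖ) = 1`. -/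
theorem exists_apply_self_eq_one (h : IsUnramifiedInvolution A τ ϖ) (hφ : IsHermitianSpace φ)
    {w w' : V} (hw : φ w w = ϖ) (hw' : φ w' w' = ϖ) (hww' : φ w' w = 0) :
    ∃ a b : K, φ (a • w + b • w') (a • w + b • w') = 1 := by
  have hmem : ϖ - 1 ∈ integralClosure A K := sub_mem h.mem (one_mem _)
  have hnot : ϖ⁻¹ * (ϖ - 1) ∉ integralClosure A K := by
    rw [mul_sub, inv_mul_cancel₀ h.ne_zero, mul_one]
    exact fun h' => h.inv_notMem (by simpa using sub_mem (one_mem _) h')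
  obtain ⟨x, -, hx⟩ := h.exists_norm _ hmem (h.inv_mem_of_notMem hmem hnot)
    (by rw [map_sub, map_one, h.conj_eq])
  have hϖ0 := h.ne_zero
  refine ⟨ϖ⁻¹ * x, ϖ⁻¹, ?_⟩
  rw [apply_add_smul_self hφ, apply_smul_self, hw, hw', apply_smul_left,
    hφ.apply_eq_zero_comm hww', map_mul, map_inv₀, h.conj_eq,
    show ϖ⁻¹ * x * (ϖ⁻¹ * τ x) = ϖ⁻¹ * ϖ⁻¹ * (x * τ x) by ring, hx]
  simp only [mul_zero, map_zero, add_zero]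
  field_simp
  ring

/-- Every Hermitian space has an orthogonal basis in which all vectors have value one, except
possibly one vector of value `ϖ`. -/
theorem exists_orthogonal_basis (h : IsUnramifiedInvolution A τ ϖ) (hφ : IsHermitianSpace φ) :
    ∃ m : ℕ, (∃ b : Module.Basis (Fin m) K V, IsDiagonal φ b fun _ => 1) ∨
      ∃ b : Module.Basis (Fin (m + 1)) K V, IsDiagonal φ b (Fin.cons ϖ fun _ => 1) := by
  obtain ⟨m, u, hu, -, hmax⟩ := exists_orthonormal_maximal hφ Set.univ
  have hmax (z : V) (hz : ∀ i, φ z (u i) = 0) : φ z z ≠ 1 := hmax z trivial hz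
  have hscale (w : V) (hwu : ∀ i, φ w (u i) = 0) (hw : φ w w ≠ 0) :
      ∃ a : K, φ (a • w) (a • w) = ϖ := by
    obtain ⟨a, ha | ha⟩ := exists_smul_apply_self_eq_one_or h hφ hw
    · exact absurd ha (hmax _ fun i => by rw [apply_smul_left, hwu, mul_zero])
    · exact ⟨a, ha⟩
  refine ⟨m, ?_⟩
  by_cases hspan : ⊤ ≤ Submodule.span K (Set.range u)
  · exact .inl ⟨Module.Basis.mk (hu.linearIndependent fun _ => one_ne_zero) hspan,
      by rwa [Module.Basis.coe_mk]⟩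
  right
  obtain ⟨w, hwu, hw⟩ :=
    exists_orthogonal_apply_self_ne_zero h hφ hu (fun _ => one_ne_zero) hspan
  obtain ⟨a, ha⟩ := hscale w hwu hw
  have hawu (i : Fin m) : φ (a • w) (u i) = 0 := by rw [apply_smul_left, hwu, mul_zero]
  have hcons := hu.cons hφ ha hawu
  have hd : ∀ i, (Fin.cons ϖ fun _ => 1 : Fin (m + 1) → K) i ≠ 0 :=
    Fin.cases h.ne_zero fun _ => one_ne_zero
  suffices hspan' : ⊤ ≤ Submodule.span K (Set.range (Fin.cons (a • w) u : Fin (m + 1) → V)) from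
    ⟨Module.Basis.mk (hcons.linearIndependent hd) hspan', by rwa [Module.Basis.coe_mk]⟩
  by_contra hspan'
  obtain ⟨w', hw'v, hw'⟩ := exists_orthogonal_apply_self_ne_zero h hφ hcons hd hspan'
  have hw'u (i : Fin m) : φ w' (u i) = 0 := hw'v i.succ
  obtain ⟨a', ha'⟩ := hscale w' hw'u hw'
  obtain ⟨c, c', hone⟩ := exists_apply_self_eq_one h hφ ha ha'
    (by rw [apply_smul_left, show φ w' (a • w) = 0 from hw'v 0, mul_zero])
  refine hmax _ (fun i => ?_) hone
  rw [map_add, LinearMap.add_apply, apply_smul_left _ c, apply_smul_left _ c',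
    apply_smul_left _ a', hawu,
    hw'u, mul_zero, mul_zero, mul_zero, add_zero]

end Space

end HermitianLattices

theorem theorem7p1
    {k : Type*} [Field k] [ValuativeRel k] [TopologicalSpace k] [IsNonarchimedeanLocalField k]
    {K : Type*} [Field K] [Algebra k K]
    (hK : HermitianLattices.IsUnramifiedQuadratic k K)
    (τ : K ≃ₐ[k] K) (hτ : τ ≠ 1)
    {V : Type*} [AddCommGroup V] [Module K V]
    (φ : V →ₗ[K] V →ₛₗ[(τ : K →+* K)] K)
    (hφ : HermitianLattices.IsHermitianSpace φ)
    (n : ℕ) (hn : 1 ≤ n) (hV : Module.finrank K V = n) :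
    (HermitianLattices.DetIsNorm φ →
      (∃ L : Submodule (integralClosure 𝒪[k] K) V,
        HermitianLattices.IsHermitianLattice φ L ∧ HermitianLattices.IsSelfDual φ L) ∧
      (∀ L M : Submodule (integralClosure 𝒪[k] K) V,
        HermitianLattices.IsHermitianLattice φ L → HermitianLattices.IsSelfDual φ L →
        HermitianLattices.IsHermitianLattice φ M → HermitianLattices.IsSelfDual φ M →
        HermitianLattices.UnitaryConjugate φ L M)) ∧
    (¬ HermitianLattices.DetIsNorm φ →
      (¬ ∃ L : Submodule (integralClosure 𝒪[k] K) V,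
        HermitianLattices.IsHermitianLattice φ L ∧ HermitianLattices.IsSelfDual φ L) ∧
      (∃ L : Submodule (integralClosure 𝒪[k] K) V,
        HermitianLattices.IsHermitianLattice φ L ∧
        HermitianLattices.DiscIsOneDimensional φ L) ∧
      (∀ L : Submodule (integralClosure 𝒪[k] K) V,
        HermitianLattices.IsHermitianLattice φ L → HermitianLattices.DiscIsOneDimensional φ L →
        ∀ π : 𝒪[k], Irreducible π → HermitianLattices.DiscIsHermitian φ L π) ∧
      (∀ L M : Submodule (integralClosure 𝒪[k] K) V,
        HermitianLattices.IsHermitianLattice φ L → HermitianLattices.DiscIsOneDimensional φ L →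
        HermitianLattices.IsHermitianLattice φ M → HermitianLattices.DiscIsOneDimensional φ M →
        HermitianLattices.UnitaryConjugate φ L M)) := by
  open HermitianLattices in
  have h2 := hK.finrank_eq_two
  have := hK.unramified
  have hinv (ϖ : 𝒪[k]) (hϖ : Irreducible ϖ) :
      IsUnramifiedInvolution 𝒪[k] τ (algebraMap 𝒪[k] K ϖ) := by
    -- completeness, hence Hensel's lemma, is stated for the uniform structure of `k`
    let := IsTopologicalAddGroup.rightUniformSpace k
    have := isUniformAddGroup_of_addCommGroup (G := k)
    have : FaithfulSMul 𝒪[k] K := FaithfulSMul.trans 𝒪[k] k K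
    exact isUnramifiedInvolution h2 hτ hϖ
  obtain ⟨ϖ, hϖ⟩ := IsDiscreteValuationRing.exists_irreducible 𝒪[k]
  have h := hinv ϖ hϖ
  have hd (m : ℕ) : ∀ i, (Fin.cons (algebraMap 𝒪[k] K ϖ) fun _ => 1 : Fin (m + 1) → K) i ≠ 0 :=
    Fin.cases h.ne_zero fun _ => one_ne_zero
  have hnorm {m : ℕ} {b : Module.Basis (Fin m) K V} (hb : IsDiagonal φ b fun _ => 1) :
      DetIsNorm φ := by
    refine (hb.detIsNorm_iff h2 hτ).2 ⟨1, ?_⟩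
    simp
  have hnotNorm {m : ℕ} {b : Module.Basis (Fin (m + 1)) K V}
      (hb : IsDiagonal φ b (Fin.cons (algebraMap 𝒪[k] K ϖ) fun _ => 1)) : ¬ DetIsNorm φ := by
    rw [hb.detIsNorm_iff h2 hτ]
    rintro ⟨z, hz⟩
    rw [Fin.prod_univ_succ] at hz
    exact h.ne_mul_conj z.ne_zero (by simpa using hz)
  refine ⟨fun hdet => ⟨?_, fun L M hL hL' hM hM' => ?_⟩,
    fun hdet => ⟨?_, ?_, fun L hL hL' π hπ => ?_, fun L M hL hL' hM hM' => ?_⟩⟩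
  · obtain ⟨m, ⟨b, hb⟩ | ⟨b, hb⟩⟩ := exists_orthogonal_basis h hφ
    · refine ⟨_, hb.isHermitianLattice_span (fun _ => one_ne_zero) (fun _ => one_mem _) h.conj_mem,
        ?_⟩
      ext x
      rw [IsDiagonal.mem_dual_span_iff h.conj_mem, hb.mem_span_iff fun _ => one_ne_zero]
      simp only [div_one]
    · exact absurd hdet (hnotNorm hb)
  · obtain ⟨m, b, hb, rfl⟩ := exists_orthonormal_basis_of_isSelfDual h hφ hL hL'
    obtain ⟨m', b', hb', rfl⟩ := exists_orthonormal_basis_of_isSelfDual h hφ hM hM'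
    obtain rfl : m = m' := by
      rw [← Module.finrank_eq_card_basis b |>.trans (Fintype.card_fin m),
        Module.finrank_eq_card_basis b', Fintype.card_fin]
    exact hb.unitaryConjugate_span hb'
  · rintro ⟨L, hL, hL'⟩
    obtain ⟨m, b, hb, -⟩ := exists_orthonormal_basis_of_isSelfDual h hφ hL hL'
    exact hdet (hnorm hb)
  · obtain ⟨m, ⟨b, hb⟩ | ⟨b, hb⟩⟩ := exists_orthogonal_basis h hφ
    · exact absurd (hnorm hb) hdet
    · exact ⟨_, hb.isHermitianLattice_span (hd m) (Fin.cases h.mem fun _ => one_mem _) h.conj_mem,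
        discIsOneDimensional_span h hb⟩
  · obtain ⟨m, b, hb, rfl⟩ := exists_orthogonal_basis_of_discIsOneDimensional h hφ hL hL'
    exact discIsHermitian_span (hinv π hπ) hφ hb (hd m)
      fun x hx => smul_mem_of_discIsOneDimensional (hinv π hπ) hL' hx
  · obtain ⟨m, b, hb, rfl⟩ := exists_orthogonal_basis_of_discIsOneDimensional h hφ hL hL'
    obtain ⟨m', b', hb', rfl⟩ := exists_orthogonal_basis_of_discIsOneDimensional h hφ hM hM'
    obtain rfl : m = m' := by
      have h1 := Module.finrank_eq_card_basis b
      rw [Module.finrank_eq_card_basis b', Fintype.card_fin, Fintype.card_fin] at h1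
      omega
    exact hb.unitaryConjugate_span hb'
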